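/- **Setting.** Let $\mathcal X,\mathcal A$ be finite, $r:\mathcal X\times\mathcal A\to[0,1]$ a reward function and $p(\cdot\mid x,a)$ a transition kernel, forming a linear MDP with known features $\varphi:\mathcal X\times\mathcal A\to\mathbb R^d$: there are $\omega\in\mathbb R^d$ and $\psi:\mathcal X\to\mathbb R^d$ with $r(x,a)=\langle\varphi(x,a),\omega\rangle$ and $p(x'\mid x,a)=\langle\varphi(x,a),\psi(x')\rangle$. Assume $\|\varphi(x,a)\|_2\le D_\varphi$ for all $(x,a)$ and that some $\varrho\in\mathbb R^d$ satisfies $\langle\varphi(x,a),\varrho\rangle=1$ for all $(x,a)$. For a stationary policy $\pi$, let $\rho^\pi=\liminf_{T\to\infty}\frac1T\mathbb E_\pi[\sum_{t=1}^T r(x_t,a_t)\mid x_1=x]$, assumed not to depend on $x$, and let $\mu^\pi$ be an occupancy measure of $\pi$, i.e. a probability distribution $\mu^\pi(x,a)=\nu^\pi(x)\pi(a\mid x)$ with $\nu^\pi(x')=\sum_{x,a}\mu^\pi(x,a)p(x'\mid x,a)$ (if it is not unique, fix any choice for each $\pi$). Assume that for every $\pi$ there is $\theta^\pi$ with $\|\theta^\pi\|_2\le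 D_\theta$ such that $q^\pi(x,a)=\langle\varphi(x,a),\theta^\pi\rangle$ solves the Bellman equations $q^\pi(x,a)=r(x,a)-\rho^\pi+\sum_{x'}p(x'\mid x,a)\sum_{a'}\pi(a'\mid x')q^\pi(x',a')$. Let $\pi_B$ be a behavior policy, $\mu_B=\mu^{\pi_B}$, and let $\Lambda=\mathbb E_{(X,A)\sim\mu_B}[\varphi(X,A)\varphi(X,A)^{\mathsf T}]$ be invertible. Let $c\in\{\tfrac12,1\}$, let $\pi^*$ be any comparator policy, and suppose that the coverage ratio $C_{\varphi,c}(\pi^*;\pi_B)=\mathbb E_{\mu^{\pi^*}}[\varphi]^{\mathsf T}\Lambda^{-2c}\,\mathbb E_{\mu^{\pi^*}}[\varphi]$ satisfies $C_{\varphi,c}(\pi^*;\pi_B)\le D_\beta^2$, $D_\beta\ge0$. **Algorithm.** Samples $(X,A,R,X')$ are i.i.d. with $(X,A)\sim\mu_B$, $R=r(X,A)$, $X'\sim p(\cdot\mid X,A)$. Inputs: $\zeta,\alpha,\xi,\eta>0$, $T,K\ge1$, $\|\beta_1\|_2\le D_\beta$, $\rho_0\in[0,1]$, $\|\theta_0\|_2\le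 D_\theta$. With $\Pi$ denoting Euclidean projection and $B(D)$ the centered Euclidean ball of radius $D$, for $t=1,\dots,T$: * let $\pi_t(a\mid x)\propto\exp(\alpha\sum_{k<t}\langle\varphi(x,a),\theta_k\rangle)$, $\rho_t^{(1)}=\rho_{t-1}$, $\theta_t^{(1)}=\theta_{t-1}$; * for $i=1,\dots,K$: draw a fresh sample $(X,A,R,X')$ and $A'\sim\pi_t(\cdot\mid X')$, put $u=\langle\varphi(X,A),\Lambda^{c-1}\beta_t\rangle$, $\rho_t^{(i+1)}=\Pi_{[0,1]}(\rho_t^{(i)}-\xi(1-u))$, $\theta_t^{(i+1)}=\Pi_{B(D_\theta)}(\theta_t^{(i)}-\eta u(\varphi(X',A')-\varphi(X,A)))$; * let $\rho_t=\frac1K\sum_{i\le K}\rho_t^{(i)}$, $\theta_t=\frac1K\sum_{i\le K}\theta_t^{(i)}$; draw a fresh sample $(X,A,R,X')$ and let $\beta_{t+1}=\Pi_{B(D_\beta)}\big(\beta_t+\zeta\Lambda^{c-1}\varphi(X,A)[R+\sum_a\pi_t(a\mid X')\langle\varphi(X',a),\theta_t\rangle-\langle\theta_t,\varphi(X,A)\rangle-\rho_t]\big)$.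 Output $\pi_{\rm out}=\pi_J$ with $J$ uniform on $\{1,\dots,T\}$. **(1) Regret bound.** The algorithm uses exactly $n=T(K+1)$ samples, and $$\mathbb E\,\langle\mu^{\pi^*}-\mu^{\pi_{\rm out}},r\rangle\le\frac{2D_\beta^2}{\zeta T}+\frac{\log|\mathcal A|}{\alpha T}+\frac1{2\xi K}+\frac{2D_\theta^2}{\eta K}+\frac{\zeta G_\beta^2}2+\frac{\alpha D_\theta^2D_\varphi^2}2+\frac{\xi G_\rho^2}2+\frac{\eta G_\theta^2}2,$$ where $G_\beta^2=\tau(1+2D_\theta D_\varphi)^2$, $G_\rho^2=2(1+D_\beta^2\ell)$, $G_\theta^2=4D_\varphi^2D_\beta^2\ell$ with $\tau=\mathrm{Tr}(\Lambda^{2c-1})$, $\ell=\|\Lambda\|_2^{2c-1}$. **(2) Sample complexity.** There is a universal constant $C$ such that the following holds whenever $0<\varepsilon\le1$, $|\mathcal A|\ge2$ and $D_\theta D_\varphi\ge1$. Put $N_1=4D_\beta^2G_\beta^2+2D_\theta^2D_\varphi^2\log|\mathcal A|$, $N_2=G_\rho^2+4D_\theta^2G_\theta^2$, $T=\lceil 8N_1/\varepsilon^2\rceil$,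 $K=\lceil T N_2/N_1\rceil$, $\zeta=\frac{2D_\beta}{G_\beta\sqrt T}$, $\alpha=\frac{\sqrt{2\log|\mathcal A|}}{D_\theta D_\varphi\sqrt T}$, $\xi=\frac1{G_\rho\sqrt K}$, $\eta=\frac{2D_\theta}{G_\theta\sqrt K}$. (a) With $\tau=\mathrm{Tr}(\Lambda^{2c-1})$, $\ell=\|\Lambda\|_2^{2c-1}$, the algorithm satisfies $\mathbb E\langle\mu^{\pi^*}-\mu^{\pi_{\rm out}},r\rangle\le\varepsilon$, and $n=T(K+1)\le C\varepsilon^{-4}D_\theta^4D_\varphi^4D_\beta^4\,\mathrm{Tr}(\Lambda^{2c-1})\|\Lambda\|_2^{2c-1}\log|\mathcal A|$; in particular, if $\|\Lambda\|_2\ge1$, then $n\le C\varepsilon^{-4}D_\theta^4D_\varphi^4D_\beta^4\,\mathrm{Tr}(\Lambda^{2c-1})\|\Lambda\|_2^{2(2c-1)}\log|\mathcal A|$. (b) If $D_\varphi\ge1$, then with the same formulas for $\tau=D_\varphi^{2(2c-1)}d^{2-2c}$, $\ell=D_\varphi^{2(2c-1)}$ in place of the above (so that for $c=1$ nothing depends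 on $\Lambda$), the algorithm satisfies $\mathbb E\langle\mu^{\pi^*}-\mu^{\pi_{\rm out}},r\rangle\le\varepsilon$, and $n=T(K+1)\le C\varepsilon^{-4}D_\theta^4D_\varphi^{12c-2}D_\beta^4d^{2-2c}\log|\mathcal A|$. -/

import Mathlib

open scoped MatrixOrder

noncomputable section

namespace AvgReward

/-- `ℝ^d` with the Euclidean norm. -/
abbrev Vec (d : ℕ) : Type := EuclideanSpace ℝ (Fin d)

/-- A matrix acting on `ℝ^d`. -/
def act {d : ℕ} (B : Matrix (Fin d) (Fin d) ℝ) (v : Vec d) : Vec d :=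
  Matrix.toEuclideanCLM (n := Fin d) (𝕜 := ℝ) B v

/-- The spectral norm of a matrix. -/
def specNorm {d : ℕ} (B : Matrix (Fin d) (Fin d) ℝ) : ℝ :=
  ‖Matrix.toEuclideanCLM (n := Fin d) (𝕜 := ℝ) B‖

/-- Expectation of a real function under a discrete law. -/
def expect {α : Type*} (p : PMF α) (f : α → ℝ) : ℝ := ∑' a, (p a).toReal * f a

/-! ### Average-reward Markov decision processes -/

/-- A finite MDP with deterministic rewards in `[0,1]`. -/
structure MDP (X A : Type*) where
  /-- `P x a` is the law of the next state -/
  P : X → A → PMF X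
  /-- the reward function -/
  r : X → A → ℝ
  r_nonneg : ∀ x a, 0 ≤ r x a
  r_le_one : ∀ x a, r x a ≤ 1

/-- Stationary stochastic policies. -/
abbrev Policy (X A : Type*) := X → PMF A

section MDPNotions

variable {X A : Type*} [Fintype X] [Fintype A]

/-- Linear MDP with feature map `φ`: `r(x,a) = ⟨φ(x,a), ω⟩`, `p(x'|x,a) = ⟨φ(x,a), ψ(x')⟩`. -/
def MDP.IsLinear {d : ℕ} (M : MDP X A) (φ : X → A → Vec d) : Prop :=
  ∃ (ψ : X → Vec d) (ω : Vec d), ∀ x a,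
    M.r x a = inner ℝ (φ x a) ω ∧ ∀ x', (M.P x a x').toReal = inner ℝ (φ x a) (ψ x')

/-- The law of the state after `n` steps of policy `π` started in state `x`. -/
def MDP.stateLaw (M : MDP X A) (π : Policy X A) (x : X) : ℕ → PMF X
  | 0 => PMF.pure x
  | n + 1 => (M.stateLaw π x n).bind fun y => (π y).bind fun a => M.P y a

/-- The expected reward collected in step `n` by policy `π` started in state `x`. -/
def MDP.rewardAt (M : MDP X A) (π : Policy X A) (x : X) (n : ℕ) : ℝ :=
  ∑ y, (M.stateLaw π x n y).toReal * ∑ a, (π y a).toReal * M.r y a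

/-- The long-term average reward `liminf_T (1/T) E_π[∑_{t=1}^T r(x_t,a_t) | x_1 = x]`. -/
def MDP.gain (M : MDP X A) (π : Policy X A) (x : X) : ℝ :=
  Filter.liminf (fun T : ℕ => (1 / (T : ℝ)) * ∑ t ∈ Finset.range T, M.rewardAt π x t) Filter.atTop

/-- `q` is a bias (relative action-value) function of `π`: the average reward does not depend on the
initial state, and `q` solves the Bellman equations `q = r - ρ^π 1 + P v`,
`v(x) = ∑_a π(a|x) q(x,a)`. -/
def MDP.IsBias (M : MDP X A) (π : Policy X A) (q : X → A → ℝ) : Prop :=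
  ∃ ρ : ℝ, (∀ x, M.gain π x = ρ) ∧
    ∀ x a, q x a = M.r x a - ρ
      + ∑ x', (M.P x a x').toReal * ∑ a', (π x' a').toReal * q x' a'

/-- `μ` is an (undiscounted) state-action occupancy measure of `π`: its state marginal is
stationary, and actions are drawn from `π`. -/
structure MDP.IsOccupancy (M : MDP X A) (π : Policy X A) (μ : PMF (X × A)) : Prop where
  flow : ∀ x', ∑ a, μ (x', a) = ∑ z : X × A, μ z * M.P z.1 z.2 x'
  policy : ∀ x a, μ (x, a) = (∑ b, μ (x, b)) * π x a

/-- `⟨μ, r⟩`. -/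
def MDP.value (M : MDP X A) (μ : PMF (X × A)) : ℝ :=
  ∑ z : X × A, (μ z).toReal * M.r z.1 z.2

/-- The feature covariance matrix `Λ = E_{(x,a) ∼ μ}[φ(x,a) φ(x,a)ᵀ]`. -/
def covariance {d : ℕ} (φ : X → A → Vec d) (μ : PMF (X × A)) : Matrix (Fin d) (Fin d) ℝ :=
  ∑ z : X × A, (μ z).toReal • Matrix.vecMulVec (φ z.1 z.2).ofLp (φ z.1 z.2).ofLp

/-- The mean feature vector `Φᵀμ = E_{(x,a) ∼ μ}[φ(x,a)]`. -/
def meanFeature {d : ℕ} (φ : X → A → Vec d) (μ : PMF (X × A)) : Vec d :=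
  ∑ z : X × A, (μ z).toReal • φ z.1 z.2

/-- The generalized coverage ratio `(Φᵀμ)ᵀ Λ^{-2c} (Φᵀμ)`, where `Λ` is the covariance under `μB`. -/
def coverage {d : ℕ} (φ : X → A → Vec d) (c : ℝ) (μ μB : PMF (X × A)) : ℝ :=
  inner ℝ (meanFeature φ μ) (act (covariance φ μB ^ (-2 * c)) (meanFeature φ μ))

end MDPNotions

/-! ### Data -/

/-- One observed transition `(X, A, R, X')`. -/
structure Sample (X A : Type*) where
  x : X
  a : A
  rew : ℝ
  x' : X

/-- The law of one observation: `(X,A) ∼ μB`, `R = r(X,A)`, `X' ∼ p(·|X,A)`. -/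
def MDP.sampleLaw {X A : Type*} (M : MDP X A) (μB : PMF (X × A)) : PMF (Sample X A) :=
  μB.bind fun z => (M.P z.1 z.2).map fun x' => ⟨z.1, z.2, M.r z.1 z.2, x'⟩

/-! ### The algorithm -/

/-- Euclidean projection onto the closed ball of radius `D` around the origin. -/
def projBall {d : ℕ} (D : ℝ) (y : Vec d) : Vec d :=
  if ‖y‖ ≤ D then y else (D / ‖y‖) • y

/-- Projection onto `[0,1]`. -/
def projUnit (y : ℝ) : ℝ := max 0 (min 1 y)

/-- The softmax distribution, proportional to `exp (z a)`. -/
def softmax {A : Type*} [Fintype A] [Nonempty A] (z : A → ℝ) : PMF A :=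
  PMF.ofFintype (fun a => ENNReal.ofReal (Real.exp (z a) / ∑ b, Real.exp (z b))) (by
    have hpos : 0 < ∑ b, Real.exp (z b) :=
      Finset.sum_pos (fun b _ => Real.exp_pos _) Finset.univ_nonempty
    rw [← ENNReal.ofReal_sum_of_nonneg (fun a _ => by positivity), ← Finset.sum_div,
      div_self hpos.ne', ENNReal.ofReal_one])

/-- The four learning rates. -/
structure Rates where
  ζ : ℝ
  α : ℝ
  ξ : ℝ
  η : ℝ

/-- The initial iterates `β₁, ρ₀, θ₀`. -/
structure Init (d : ℕ) where
  β : Vec d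
  ρ : ℝ
  θ : Vec d

/-- Initial iterates are feasible. -/
structure Init.Feasible {d : ℕ} (i : Init d) (Dθ Dβ : ℝ) : Prop where
  β_mem : ‖i.β‖ ≤ Dβ
  ρ_mem : i.ρ ∈ Set.Icc (0 : ℝ) 1
  θ_mem : ‖i.θ‖ ≤ Dθ

/-- State of the inner loop: current `ρ_t^{(i)}` and `θ_t^{(i)}`, the sums of the previous ones, and
the number of samples drawn so far. -/
structure InnerState (d : ℕ) where
  ρ : ℝ
  θ : Vec d
  sumρ : ℝ
  sumθ : Vec d
  used : ℕ

/-- State of the outer loop after `t` rounds: `β_{t+1}`, `ρ_t`, `θ_t`, `∑_{k ≤ t} θ_k`, the policies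
played so far (`hist k` is the policy of round `k + 1`), and the number of samples drawn so far. -/
structure OuterState (X A : Type*) (d : ℕ) where
  β : Vec d
  ρ : ℝ
  θ : Vec d
  sumθ : Vec d
  hist : ℕ → Policy X A
  used : ℕ

section Algorithm

variable {X A : Type*} [Fintype A] [Nonempty A] {d : ℕ}

/-- The policy `σ(α ∑_k Φ θ_k)`, as a function of `S = ∑_k θ_k`; for `S = 0` it is the uniform
policy. -/
def softmaxPolicy (φ : X → A → Vec d) (α : ℝ) (S : Vec d) : Policy X A :=
  fun x => softmax fun a => α * inner ℝ (φ x a) S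

/-- One iteration of the inner loop. It draws a fresh sample from `data` and an action
`A' ∼ π(·|X')`; here `V` stands for `Λ^{c-1}`. -/
def innerStep (data : PMF (Sample X A)) (φ : X → A → Vec d) (V : Matrix (Fin d) (Fin d) ℝ)
    (Dθ : ℝ) (lr : Rates) (π : Policy X A) (β : Vec d) (s : InnerState d) :
    PMF (InnerState d) :=
  data.bind fun w => (π w.x').bind fun a' =>
    let u : ℝ := inner ℝ (φ w.x w.a) (act V β)
    let gρ : ℝ := 1 - u
    let gθ : Vec d := u • φ w.x' a' - u • φ w.x w.a
    PMF.pure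
      { ρ := projUnit (s.ρ - lr.ξ * gρ)
        θ := projBall Dθ (s.θ - lr.η • gθ)
        sumρ := s.sumρ + s.ρ
        sumθ := s.sumθ + s.θ
        used := s.used + 1 }

/-- `k` iterations of the inner loop. -/
def innerLoop (data : PMF (Sample X A)) (φ : X → A → Vec d) (V : Matrix (Fin d) (Fin d) ℝ)
    (Dθ : ℝ) (lr : Rates) (π : Policy X A) (β : Vec d) : ℕ → InnerState d → PMF (InnerState d)
  | 0, s => PMF.pure s
  | k + 1, s => (innerLoop data φ V Dθ lr π β k s).bind (innerStep data φ V Dθ lr π β)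

/-- Round `t + 1` of the outer loop. -/
def outerStep (data : PMF (Sample X A)) (φ : X → A → Vec d) (V : Matrix (Fin d) (Fin d) ℝ)
    (Dθ Dβ : ℝ) (lr : Rates) (K : ℕ) (t : ℕ) (s : OuterState X A d) : PMF (OuterState X A d) :=
  let π : Policy X A := softmaxPolicy φ lr.α s.sumθ
  (innerLoop data φ V Dθ lr π s.β K ⟨s.ρ, s.θ, 0, 0, s.used⟩).bind fun e =>
    let ρ : ℝ := (1 / (K : ℝ)) * e.sumρ
    let θ : Vec d := (1 / (K : ℝ)) • e.sumθ
    data.bind fun w =>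
      let v : ℝ := ∑ a, (π w.x' a).toReal * inner ℝ (φ w.x' a) θ
      let gβ : Vec d := (w.rew + v - inner ℝ θ (φ w.x w.a) - ρ) • act V (φ w.x w.a)
      PMF.pure
        { β := projBall Dβ (s.β + lr.ζ • gβ)
          ρ := ρ
          θ := θ
          sumθ := s.sumθ + θ
          hist := Function.update s.hist t π
          used := e.used + 1 }

/-- The first `t` rounds of the algorithm. -/
def outerLoop (data : PMF (Sample X A)) (φ : X → A → Vec d) (V : Matrix (Fin d) (Fin d) ℝ)
    (Dθ Dβ : ℝ) (lr : Rates) (K : ℕ) (init : Init d) : ℕ → PMF (OuterState X A d)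
  | 0 => PMF.pure ⟨init.β, init.ρ, init.θ, 0, fun _ => softmaxPolicy φ lr.α 0, 0⟩
  | t + 1 => (outerLoop data φ V Dθ Dβ lr K init t).bind (outerStep data φ V Dθ Dβ lr K t)

/-- The offline primal-dual method: the joint law of the returned policy `π_J`, with `J` uniform on
the `T` rounds, and of the number of samples drawn. -/
def primalDual (data : PMF (Sample X A)) (φ : X → A → Vec d) (V : Matrix (Fin d) (Fin d) ℝ)
    (Dθ Dβ : ℝ) (lr : Rates) (T K : ℕ) (hT : 0 < T) (init : Init d) : PMF (Policy X A × ℕ) :=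
  haveI : NeZero T := ⟨hT.ne'⟩
  (outerLoop data φ V Dθ Dβ lr K init T).bind fun s =>
    (PMF.uniformOfFintype (Fin T)).map fun J => (s.hist J, s.used)

/-- The method with parameter `c`, run on i.i.d. observations from `μB`: it uses the
preconditioner `Λ^{c-1}` (the identity for `c = 1`). -/
def MDP.run [Fintype X] (M : MDP X A) (φ : X → A → Vec d) (c : ℝ) (μB : PMF (X × A)) (Dθ Dβ : ℝ)
    (lr : Rates) (T K : ℕ) (hT : 0 < T) (init : Init d) : PMF (Policy X A × ℕ) :=
  primalDual (M.sampleLaw μB) φ (covariance φ μB ^ (c - 1)) Dθ Dβ lr T K hT init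

end Algorithm

/-! ### Constants and tuning

Below `τ` and `ℓ` are `Tr(Λ^{2c-1})` and `‖Λ‖₂^{2c-1}`, or upper bounds on them. -/

/-- `G_β²`. -/
def GβSq (τ Dφ Dθ : ℝ) : ℝ := τ * (1 + 2 * Dθ * Dφ) ^ 2

/-- `G_ρ²`. -/
def GρSq (ℓ Dβ : ℝ) : ℝ := 2 * (1 + Dβ ^ 2 * ℓ)

/-- `G_θ²`. -/
def GθSq (ℓ Dφ Dβ : ℝ) : ℝ := 4 * Dφ ^ 2 * Dβ ^ 2 * ℓ

/-- The bound on the expected suboptimality. -/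
def regretBound (τ ℓ Dφ Dθ Dβ logA : ℝ) (lr : Rates) (T K : ℕ) : ℝ :=
  2 * Dβ ^ 2 / (lr.ζ * T) + logA / (lr.α * T) + 1 / (2 * lr.ξ * K) + 2 * Dθ ^ 2 / (lr.η * K)
    + lr.ζ * GβSq τ Dφ Dθ / 2 + lr.α * Dθ ^ 2 * Dφ ^ 2 / 2 + lr.ξ * GρSq ℓ Dβ / 2
    + lr.η * GθSq ℓ Dφ Dβ / 2

/-- `4 D_β² G_β² + 2 D_θ² D_φ² log|A|`. -/
def outerConst (τ Dφ Dθ Dβ logA : ℝ) : ℝ :=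
  4 * Dβ ^ 2 * GβSq τ Dφ Dθ + 2 * Dθ ^ 2 * Dφ ^ 2 * logA

/-- `G_ρ² + 4 D_θ² G_θ²`. -/
def innerConst (ℓ Dφ Dθ Dβ : ℝ) : ℝ := GρSq ℓ Dβ + 4 * Dθ ^ 2 * GθSq ℓ Dφ Dβ

/-- The tuned number of rounds for accuracy `ε`. -/
def tunedT (τ Dφ Dθ Dβ logA ε : ℝ) : ℕ := ⌈8 * outerConst τ Dφ Dθ Dβ logA / ε ^ 2⌉₊

/-- The tuned number of inner iterations for `T` rounds. -/
def tunedK (τ ℓ Dφ Dθ Dβ logA : ℝ) (T : ℕ) : ℕ :=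
  ⌈(T : ℝ) * (innerConst ℓ Dφ Dθ Dβ / outerConst τ Dφ Dθ Dβ logA)⌉₊

/-- The tuned learning rates. -/
def tunedRates (τ ℓ Dφ Dθ Dβ logA : ℝ) (T K : ℕ) : Rates where
  ζ := 2 * Dβ / (√(GβSq τ Dφ Dθ) * √(T : ℝ))
  α := √(2 * logA) / (Dθ * Dφ * √(T : ℝ))
  ξ := 1 / (√(GρSq ℓ Dβ) * √(K : ℝ))
  η := 2 * Dθ / (√(GθSq ℓ Dφ Dβ) * √(K : ℝ))

end AvgReward

end

open AvgReward

open scoped MatrixOrder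

noncomputable section

namespace AvgReward

open Finset

set_option linter.unusedSectionVars false

/-! ### Expectations under laws with finite support -/

section Expect

variable {α β : Type*}

/-! The method seeks a saddle point of the Lagrangian `ρ + E_{μB}[w_β · δ]`, where `w_β = ⟨φ,
Λ^{c-1}β⟩` and `δ` is the Bellman error of `⟨φ, θ⟩` with gain `ρ` under the current policy `π`.
Write `U = E_{μB}[w_β · δ]`.

Two evaluations of the Lagrangian matter. In a linear MDP `δ` is linear in `φ`
(`exists_bellmanError_eq_inner`), so the comparator `β* = Λ^{-c} E_{μ*}[φ]`, whose squared norm is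
the coverage ratio, turns the `μB`-average into a `μ*`-average (`exists_dual_comparator`). This
gives `E_{μB}[w_{β*} δ] = ⟨μ*, r⟩ + Q - ρ`, with `Q` the gap between playing `π` and `π*` on the
states of `μ*`, measured by `⟨φ, θ⟩`. On the other side, the Bellman error of the bias function of
`π` vanishes, so `ρ + U - ⟨μ^π, r⟩` is linear in the distance of `(ρ, θ)` from `(ρ^π, θ^π)`
(`lagrangian_gap`).

Hence `⟨μ* - μ^π, r⟩ = (⟨μ*, r⟩ + Q - ρ - U) - Q + (ρ + U - ⟨μ^π, r⟩)`. The three terms are the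
regrets of stochastic gradient ascent in `β`, of exponential weights in the policy, and of the
averaged inner gradient descent in `(ρ, θ)`. Each is bounded by a potential whose expected increment
per step is controlled (`expect_dual_step_le`, `policyPotential_add_le`, `innerLoop_potential_le`).
The second moments of the gradients give `Tr(Λ^{2c-1})` and `‖Λ‖^{2c-1}`.

Tuning balances each pair `a²/(2ηn) + ηG/2`. The sample bound is the product of `T ~ N₁/ε²` and `K ~
N₂/ε²`; additive constants are absorbed by means of `1 ≤ Dβ² ℓ`, which holds because the comparator
weights have mean one under `μB`. -/

theorem finite_support_pure (a : α) : (PMF.pure a).support.Finite := by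
  simp [PMF.support_pure]

theorem finite_support_bind {p : PMF α} {g : α → PMF β} (hp : p.support.Finite)
    (hg : ∀ a, (g a).support.Finite) : (p.bind g).support.Finite := by
  rw [PMF.support_bind]
  exact hp.biUnion fun a _ => hg a

theorem finite_support_map {p : PMF α} (f : α → β) (hp : p.support.Finite) :
    (p.map f).support.Finite := by
  rw [PMF.support_map]
  exact hp.image f

theorem expect_eq_sum {p : PMF α} {s : Finset α} (h : p.support ⊆ s) (f : α → ℝ) :
    expect p f = ∑ a ∈ s, (p a).toReal * f a := by
  refine tsum_eq_sum fun a ha => ?_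
  have : p a = 0 := by
    by_contra h0
    exact ha (h ((PMF.mem_support_iff p a).2 h0))
  simp [this]

theorem expect_fintype [Fintype α] (p : PMF α) (f : α → ℝ) :
    expect p f = ∑ a, (p a).toReal * f a :=
  tsum_fintype _

theorem expect_pure (a : α) (f : α → ℝ) : expect (PMF.pure a) f = f a := by
  classical
  rw [expect_eq_sum (s := {a}) (by simp [PMF.support_pure])]
  simp

theorem sum_toReal {p : PMF α} {s : Finset α} (h : p.support ⊆ s) :
    ∑ a ∈ s, (p a).toReal = 1 := by
  rw [← ENNReal.toReal_sum fun a _ => p.apply_ne_top a]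
  have : ∑ a ∈ s, p a = 1 := by
    rw [← p.tsum_coe]
    refine (tsum_eq_sum fun a ha => ?_).symm
    by_contra h0
    exact ha (h ((PMF.mem_support_iff p a).2 h0))
  rw [this, ENNReal.toReal_one]

theorem sum_univ_toReal [Fintype α] (p : PMF α) : ∑ a, (p a).toReal = 1 :=
  sum_toReal (by simp)

/-- Finite supports reduce the exchange of two series to `sum_comm`, so that no summability or bound
on `f` is required. -/
theorem expect_bind {p : PMF α} {g : α → PMF β} (hp : p.support.Finite)
    (hg : ∀ a, (g a).support.Finite) (f : β → ℝ) :
    expect (p.bind g) f = expect p fun a => expect (g a) f := by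
  classical
  set s := hp.toFinset with hs
  have hs' : p.support ⊆ s := by simp [hs]
  set t := s.biUnion fun a => (hg a).toFinset with ht
  have hgt : ∀ a ∈ s, (g a).support ⊆ t := by
    intro a ha b hb
    rw [ht, mem_coe, mem_biUnion]
    exact ⟨a, ha, by simpa using hb⟩
  have hbt : (p.bind g).support ⊆ t := by
    intro b hb
    rw [PMF.support_bind] at hb
    simp only [Set.mem_iUnion] at hb
    obtain ⟨a, ha, hb⟩ := hb
    exact hgt a (hs' ha) hb
  rw [expect_eq_sum hbt, expect_eq_sum hs']
  have hb : ∀ b, ((p.bind g) b).toReal = ∑ a ∈ s, (p a).toReal * (g a b).toReal := by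
    intro b
    rw [PMF.bind_apply, tsum_eq_sum (s := s), ENNReal.toReal_sum]
    · simp [ENNReal.toReal_mul]
    · intro a _
      exact ENNReal.mul_ne_top (p.apply_ne_top a) ((g a).apply_ne_top b)
    · intro a ha
      have : p a = 0 := by
        by_contra h0
        exact ha (hs' ((PMF.mem_support_iff p a).2 h0))
      simp [this]
  simp_rw [hb, sum_mul]
  rw [sum_comm]
  refine sum_congr rfl fun a ha => ?_
  rw [expect_eq_sum (hgt a ha), mul_sum]
  exact sum_congr rfl fun b _ => by ring

theorem expect_map {p : PMF α} (hp : p.support.Finite) (h : α → β) (f : β → ℝ) :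
    expect (p.map h) f = expect p fun a => f (h a) := by
  rw [PMF.map, expect_bind hp (g := PMF.pure ∘ h) fun a => finite_support_pure (h a)]
  simp [expect_pure]

theorem expect_mono {p : PMF α} (hp : p.support.Finite) {f g : α → ℝ}
    (h : ∀ a ∈ p.support, f a ≤ g a) : expect p f ≤ expect p g := by
  have hs : p.support ⊆ hp.toFinset := by simp
  rw [expect_eq_sum hs, expect_eq_sum hs]
  exact sum_le_sum fun a ha =>
    mul_le_mul_of_nonneg_left (h a (by simpa using ha)) ENNReal.toReal_nonneg

theorem expect_add {p : PMF α} (hp : p.support.Finite) (f g : α → ℝ) :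
    expect p (fun a => f a + g a) = expect p f + expect p g := by
  have hs : p.support ⊆ hp.toFinset := by simp
  simp only [expect_eq_sum hs, mul_add, sum_add_distrib]

theorem expect_const {p : PMF α} (hp : p.support.Finite) (k : ℝ) :
    expect p (fun _ => k) = k := by
  have hs : p.support ⊆ hp.toFinset := by simp
  rw [expect_eq_sum hs, ← sum_mul, sum_toReal hs, one_mul]

theorem expect_mul_left (p : PMF α) (k : ℝ) (f : α → ℝ) :
    expect p (fun a => k * f a) = k * expect p f := by
  simp only [expect, ← tsum_mul_left]
  exact tsum_congr fun a => by ring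

theorem expect_sub {p : PMF α} (hp : p.support.Finite) (f g : α → ℝ) :
    expect p (fun a => f a - g a) = expect p f - expect p g := by
  have hs : p.support ⊆ hp.toFinset := by simp
  simp only [expect_eq_sum hs, mul_sub, sum_sub_distrib]

/-- Supplies the exact gradient as a vector, through its pairings only. -/
theorem expect_inner {E : Type*} [NormedAddCommGroup E] [InnerProductSpace ℝ E] {p : PMF α}
    (hp : p.support.Finite) (g : α → E) :
    ∃ m : E, ∀ y, expect p (fun a => inner ℝ (g a) y) = inner ℝ m y := by
  have hs : p.support ⊆ hp.toFinset := by simp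
  refine ⟨∑ a ∈ hp.toFinset, (p a).toReal • g a, fun y => ?_⟩
  simp only [expect_eq_sum hs, sum_inner, real_inner_smul_left]

end Expect

/-! ### Euclidean projections and projected gradient steps -/

theorem norm_projBall_le {d : ℕ} {D : ℝ} (hD : 0 ≤ D) (y : Vec d) : ‖projBall D y‖ ≤ D := by
  unfold projBall
  split_ifs with h
  · exact h
  · have hy : 0 < ‖y‖ := lt_of_le_of_lt hD (not_le.1 h)
    rw [norm_smul, Real.norm_of_nonneg (by positivity), div_mul_cancel₀ _ hy.ne']

/-- Outside the ball, expanding both squares leaves `2 (1 - D/‖y‖) ⟨y, z⟩ ≤ ‖y‖² - D²`.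
Cauchy–Schwarz bounds the left side by `2 (‖y‖ D - D²)`, and the slack is `(‖y‖ - D)²`. -/
theorem norm_projBall_sub_le {d : ℕ} {D : ℝ} (hD : 0 ≤ D) (y z : Vec d) (hz : ‖z‖ ≤ D) :
    ‖projBall D y - z‖ ^ 2 ≤ ‖y - z‖ ^ 2 := by
  unfold projBall
  split_ifs with h
  · exact le_rfl
  · have h := not_le.1 h
    have hy : 0 < ‖y‖ := lt_of_le_of_lt hD h
    rw [norm_sub_sq_real, norm_sub_sq_real, norm_smul, Real.norm_of_nonneg (by positivity),
      div_mul_cancel₀ _ hy.ne', real_inner_smul_left]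
    have h1 : inner ℝ y z ≤ ‖y‖ * D :=
      (real_inner_le_norm y z).trans (mul_le_mul_of_nonneg_left hz hy.le)
    have h2 : 0 ≤ 1 - D / ‖y‖ := by
      rw [sub_nonneg, div_le_one hy]; exact h.le
    have h3 : (1 - D / ‖y‖) * inner ℝ y z ≤ (1 - D / ‖y‖) * (‖y‖ * D) :=
      mul_le_mul_of_nonneg_left h1 h2
    have h4 : (1 - D / ‖y‖) * (‖y‖ * D) = ‖y‖ * D - D ^ 2 := by
      field_simp
    nlinarith [sq_nonneg (‖y‖ - D)]

theorem projUnit_mem (y : ℝ) : projUnit y ∈ Set.Icc (0 : ℝ) 1 := by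
  unfold projUnit
  exact ⟨le_max_left _ _, max_le zero_le_one (min_le_left _ _)⟩

theorem projUnit_sub_sq_le (y z : ℝ) (hz : z ∈ Set.Icc (0 : ℝ) 1) :
    (projUnit y - z) ^ 2 ≤ (y - z) ^ 2 := by
  obtain ⟨h0, h1⟩ := hz
  unfold projUnit
  rcases le_total 1 y with h | h
  · rw [min_eq_left h, max_eq_right zero_le_one]; nlinarith
  · rw [min_eq_right h]
    rcases le_total 0 y with h' | h'
    · rw [max_eq_right h']
    · rw [max_eq_left h']; nlinarith

/-- The squared distance after a projected gradient step on a ball. -/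
theorem norm_projBall_step_le {d : ℕ} {D : ℝ} (hD : 0 ≤ D) (k : ℝ) (y g z : Vec d)
    (hz : ‖z‖ ≤ D) :
    ‖projBall D (y - k • g) - z‖ ^ 2
      ≤ ‖y - z‖ ^ 2 - 2 * k * inner ℝ g (y - z) + k ^ 2 * ‖g‖ ^ 2 := by
  refine (norm_projBall_sub_le hD _ z hz).trans (le_of_eq ?_)
  rw [show y - k • g - z = (y - z) - k • g by abel, norm_sub_sq_real, real_inner_smul_right,
    norm_smul, mul_pow, Real.norm_eq_abs, sq_abs, real_inner_comm]
  ring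

/-- The squared distance after a projected gradient step on the unit interval. -/
theorem projUnit_step_le (k y g z : ℝ) (hz : z ∈ Set.Icc (0 : ℝ) 1) :
    (projUnit (y - k * g) - z) ^ 2
      ≤ (y - z) ^ 2 - 2 * k * (g * (y - z)) + k ^ 2 * g ^ 2 :=
  (projUnit_sub_sq_le _ z hz).trans (le_of_eq (by ring))

/-! ### Powers of the feature covariance matrix -/

section Act

variable {d : ℕ}

theorem act_mul (B C : Matrix (Fin d) (Fin d) ℝ) (v : Vec d) :
    act (B * C) v = act B (act C v) := by
  simp [act]

theorem act_one (v : Vec d) : act 1 v = v := by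
  simp [act]

theorem inner_act_comm {B : Matrix (Fin d) (Fin d) ℝ} (hB : 0 ≤ B) (v w : Vec d) :
    inner ℝ (act B v) w = inner ℝ v (act B w) := by
  have h : star B = B := (Matrix.nonneg_iff_posSemidef.1 hB).1
  have h2 : star (Matrix.toEuclideanCLM (n := Fin d) (𝕜 := ℝ) B)
      = Matrix.toEuclideanCLM (n := Fin d) (𝕜 := ℝ) B := by
    rw [← map_star, h]
  rw [act, ← ContinuousLinearMap.adjoint_inner_right, ← ContinuousLinearMap.star_eq_adjoint, h2,
    act]

theorem inner_act_le (B : Matrix (Fin d) (Fin d) ℝ) (v : Vec d) :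
    inner ℝ v (act B v) ≤ ‖v‖ ^ 2 * specNorm B := by
  calc inner ℝ v (act B v) ≤ ‖v‖ * ‖act B v‖ := real_inner_le_norm _ _
    _ ≤ ‖v‖ * (specNorm B * ‖v‖) := by
        gcongr
        exact ContinuousLinearMap.le_opNorm _ v
    _ = _ := by ring

theorem specNorm_nonneg (B : Matrix (Fin d) (Fin d) ℝ) : 0 ≤ specNorm B := norm_nonneg _

theorem specNorm_one_le : specNorm (1 : Matrix (Fin d) (Fin d) ℝ) ≤ 1 := by
  unfold specNorm
  rw [map_one]
  exact ContinuousLinearMap.norm_id_le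

end Act

section Covariance

variable {X A : Type*} [Fintype X] [Fintype A] {d : ℕ} (φ : X → A → Vec d) (μ : PMF (X × A))

theorem act_covariance (v : Vec d) :
    act (covariance φ μ) v
      = ∑ z, (μ z).toReal • (inner ℝ (φ z.1 z.2) v : ℝ) • φ z.1 z.2 := by
  unfold act covariance
  rw [map_sum, _root_.sum_apply]
  refine sum_congr rfl fun z _ => ?_
  rw [map_smul, _root_.smul_apply]
  congr 1
  ext i
  rw [Matrix.ofLp_toEuclideanCLM, Matrix.vecMulVec_mulVec]
  simp [PiLp.inner_apply, dotProduct, mul_comm]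

theorem inner_act_covariance (v w : Vec d) :
    inner ℝ v (act (covariance φ μ) w)
      = ∑ z, (μ z).toReal * (inner ℝ (φ z.1 z.2) v * inner ℝ (φ z.1 z.2) w) := by
  rw [act_covariance, inner_sum]
  refine sum_congr rfl fun z _ => ?_
  rw [real_inner_smul_right, real_inner_smul_right, real_inner_comm (φ z.1 z.2) v]
  ring

theorem covariance_nonneg : 0 ≤ covariance φ μ := by
  rw [Matrix.nonneg_iff_posSemidef]
  refine Matrix.posSemidef_sum _ fun z _ => ?_
  have h := Matrix.posSemidef_vecMulVec_self_star (R := ℝ) (φ z.1 z.2).ofLp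
  simp only [star_trivial] at h
  exact h.smul ENNReal.toReal_nonneg

theorem trace_mul_covariance (B : Matrix (Fin d) (Fin d) ℝ) :
    (B * covariance φ μ).trace
      = ∑ z, (μ z).toReal * inner ℝ (φ z.1 z.2) (act B (φ z.1 z.2)) := by
  unfold covariance
  rw [mul_sum, Matrix.trace_sum]
  refine sum_congr rfl fun z _ => ?_
  rw [mul_smul_comm, Matrix.trace_smul, smul_eq_mul, Matrix.mul_vecMulVec, Matrix.trace_vecMulVec,
    act, Matrix.inner_toEuclideanCLM, dotProduct_comm]

theorem trace_covariance :
    (covariance φ μ).trace = ∑ z, (μ z).toReal * ‖φ z.1 z.2‖ ^ 2 := by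
  have h := trace_mul_covariance φ μ 1
  rw [one_mul] at h
  rw [h]
  exact sum_congr rfl fun z _ => by rw [act_one, real_inner_self_eq_norm_sq]

theorem specNorm_covariance_le_trace : specNorm (covariance φ μ) ≤ (covariance φ μ).trace := by
  rw [trace_covariance]
  refine ContinuousLinearMap.opNorm_le_bound _
    (sum_nonneg fun z _ => mul_nonneg ENNReal.toReal_nonneg (sq_nonneg _)) fun v => ?_
  change ‖act (covariance φ μ) v‖ ≤ _
  rw [act_covariance, sum_mul]
  refine (norm_sum_le _ _).trans (sum_le_sum fun z _ => ?_)
  rw [norm_smul, norm_smul, Real.norm_of_nonneg ENNReal.toReal_nonneg, mul_assoc]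
  refine mul_le_mul_of_nonneg_left ?_ ENNReal.toReal_nonneg
  calc ‖(inner ℝ (φ z.1 z.2) v : ℝ)‖ * ‖φ z.1 z.2‖
      ≤ (‖φ z.1 z.2‖ * ‖v‖) * ‖φ z.1 z.2‖ := by
        gcongr
        exact norm_inner_le_norm _ _
    _ = _ := by ring

theorem trace_covariance_le {D : ℝ} (hφ : ∀ x a, ‖φ x a‖ ≤ D) :
    (covariance φ μ).trace ≤ D ^ 2 := by
  rw [trace_covariance]
  calc ∑ z, (μ z).toReal * ‖φ z.1 z.2‖ ^ 2 ≤ ∑ z, (μ z).toReal * D ^ 2 := by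
        refine sum_le_sum fun z _ => ?_
        have := hφ z.1 z.2
        gcongr
    _ = D ^ 2 := by rw [← sum_mul, sum_univ_toReal, one_mul]

/-- Since `‖Λ^{c-1}φ‖² = ⟨φ, Λ^{2c-2}φ⟩`, the mean is `Tr(Λ^{2c-2} Λ)`; invertibility of `Λ` lets
the exponents add. -/
theorem sum_norm_act_rpow_sq (hu : IsUnit (covariance φ μ)) (c : ℝ) :
    ∑ z, (μ z).toReal * ‖act (covariance φ μ ^ (c - 1)) (φ z.1 z.2)‖ ^ 2
      = (covariance φ μ ^ (2 * c - 1)).trace := by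
  have h : covariance φ μ ^ (2 * c - 1)
      = covariance φ μ ^ (c - 1) * covariance φ μ ^ (c - 1) * covariance φ μ := by
    nth_rewrite 4 [← CFC.rpow_one (covariance φ μ) (covariance_nonneg φ μ)]
    rw [← CFC.rpow_add hu, ← CFC.rpow_add hu]
    congr 1
    ring
  rw [h, trace_mul_covariance]
  refine sum_congr rfl fun z _ => ?_
  rw [act_mul, ← inner_act_comm CFC.rpow_nonneg, real_inner_self_eq_norm_sq]

/-- For the two admissible `c` the exponent is `0` or `1`, so no spectral mapping argument is
needed. -/
theorem specNorm_rpow_le {c : ℝ} (hc : c = 1 / 2 ∨ c = 1) :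
    specNorm (covariance φ μ ^ (2 * c - 1)) ≤ specNorm (covariance φ μ) ^ (2 * c - 1) := by
  rcases hc with rfl | rfl
  · rw [show (2 * (1 / 2 : ℝ) - 1) = 0 by norm_num, CFC.rpow_zero _ (covariance_nonneg φ μ),
      Real.rpow_zero]
    exact specNorm_one_le
  · rw [show (2 * (1 : ℝ) - 1) = 1 by norm_num, CFC.rpow_one _ (covariance_nonneg φ μ),
      Real.rpow_one]

/-- The second moment of the weights is the quadratic form `βᵀ Λ^{c-1} Λ Λ^{c-1} β`. -/
theorem sum_inner_act_rpow_sq_le (hu : IsUnit (covariance φ μ)) {c : ℝ} (hc : c = 1 / 2 ∨ c = 1)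
    (β : Vec d) :
    ∑ z, (μ z).toReal * (inner ℝ (φ z.1 z.2) (act (covariance φ μ ^ (c - 1)) β)) ^ 2
      ≤ ‖β‖ ^ 2 * specNorm (covariance φ μ) ^ (2 * c - 1) := by
  have h : covariance φ μ ^ (2 * c - 1)
      = covariance φ μ ^ (c - 1) * (covariance φ μ * covariance φ μ ^ (c - 1)) := by
    nth_rewrite 3 [← CFC.rpow_one (covariance φ μ) (covariance_nonneg φ μ)]
    rw [← CFC.rpow_add hu, ← CFC.rpow_add hu]
    congr 1
    ring
  have h2 := inner_act_covariance φ μ (act (covariance φ μ ^ (c - 1)) β)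
    (act (covariance φ μ ^ (c - 1)) β)
  calc _ = inner ℝ β (act (covariance φ μ ^ (2 * c - 1)) β) := by
        rw [h, act_mul, act_mul, ← inner_act_comm CFC.rpow_nonneg, h2]
        exact sum_congr rfl fun z _ => by ring
    _ ≤ ‖β‖ ^ 2 * specNorm (covariance φ μ ^ (2 * c - 1)) := inner_act_le _ _
    _ ≤ _ := mul_le_mul_of_nonneg_left (specNorm_rpow_le φ μ hc) (sq_nonneg _)

/-- The dual comparator `Λ^{-c} E_ν[φ]`. -/
theorem exists_dual_comparator (hu : IsUnit (covariance φ μ)) (c : ℝ) (ν : PMF (X × A)) :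
    ∃ β : Vec d, ‖β‖ ^ 2 = coverage φ c ν μ ∧
      ∀ y, ∑ z, (μ z).toReal * (inner ℝ (φ z.1 z.2) (act (covariance φ μ ^ (c - 1)) β)
          * inner ℝ (φ z.1 z.2) y)
        = ∑ z, (ν z).toReal * inner ℝ (φ z.1 z.2) y := by
  refine ⟨act (covariance φ μ ^ (-c)) (meanFeature φ ν), ?_, fun y => ?_⟩
  · rw [← real_inner_self_eq_norm_sq, inner_act_comm CFC.rpow_nonneg, ← act_mul,
      ← CFC.rpow_add hu, coverage]
    congr 3
    ring
  -- The exponents `1`, `c - 1` and `-c` cancel: this is why the weights of this `β` reproduce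
  -- `ν`-means of all functions linear in `φ`, for any `c`.
  · have h : covariance φ μ * (covariance φ μ ^ (c - 1) * covariance φ μ ^ (-c)) = 1 := by
      nth_rewrite 1 [← CFC.rpow_one (covariance φ μ) (covariance_nonneg φ μ)]
      rw [← CFC.rpow_add hu, ← CFC.rpow_add hu, show 1 + (c - 1 + -c) = 0 by ring,
        CFC.rpow_zero _ (covariance_nonneg φ μ)]
    rw [← inner_act_covariance, ← inner_act_comm (covariance_nonneg φ μ), ← act_mul, ← act_mul, mul_assoc,
      h, act_one, meanFeature, sum_inner]
    simp only [real_inner_smul_left]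

end Covariance

/-! ### Exponential weights -/

section Softmax

variable {A : Type*} [Fintype A]

/-- Hoeffding's lemma for a law on a finite type. -/
theorem sum_mul_exp_le (p : PMF A) (q : A → ℝ) {D : ℝ} (hD : 0 ≤ D) (hq : ∀ a, |q a| ≤ D)
    (k : ℝ) :
    ∑ a, (p a).toReal * Real.exp (k * q a)
      ≤ Real.exp (k * (∑ a, (p a).toReal * q a) + k ^ 2 * D ^ 2 / 2) := by
  let _ : MeasurableSpace A := ⊤
  have hm : AEMeasurable q p.toMeasure := (measurable_of_finite q).aemeasurable
  have h := (ProbabilityTheory.hasSubgaussianMGF_of_mem_Icc (μ := p.toMeasure) (a := -D) (b := D) hm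
    (Filter.Eventually.of_forall fun a => abs_le.1 (hq a))).mgf_le k
  rw [ProbabilityTheory.mgf, PMF.integral_eq_sum, PMF.integral_eq_sum] at h
  simp only [smul_eq_mul] at h
  -- The sub-Gaussian variance proxy is the squared half-length of `[-D, D]`.
  have hc : (((‖D - -D‖₊ / 2) ^ 2 : NNReal) : ℝ) = D ^ 2 := by
    push_cast
    rw [Real.norm_of_nonneg (by linarith)]
    ring
  rw [hc] at h
  set m := ∑ a, (p a).toReal * q a
  calc ∑ a, (p a).toReal * Real.exp (k * q a)
      = Real.exp (k * m) * ∑ a, (p a).toReal * Real.exp (k * (q a - m)) := by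
        rw [mul_sum]
        refine sum_congr rfl fun a _ => ?_
        rw [mul_left_comm, ← Real.exp_add]
        congr 2
        ring
    _ ≤ Real.exp (k * m) * Real.exp (D ^ 2 * k ^ 2 / 2) := by gcongr
    _ = _ := by rw [← Real.exp_add]; congr 1; ring

variable [Nonempty A]

theorem softmax_toReal (z : A → ℝ) (a : A) :
    (softmax z a).toReal = Real.exp (z a) / ∑ b, Real.exp (z b) := by
  rw [softmax, PMF.ofFintype_apply, ENNReal.toReal_ofReal]
  positivity

theorem sum_exp_pos (z : A → ℝ) : 0 < ∑ b, Real.exp (z b) :=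
  sum_pos (fun _ _ => Real.exp_pos _) univ_nonempty

/-- One step of exponential weights, in terms of the log-partition function. -/
theorem log_sum_exp_step_le (z q : A → ℝ) {D : ℝ} (hD : 0 ≤ D) (hq : ∀ a, |q a| ≤ D) (k : ℝ) :
    Real.log (∑ a, Real.exp (z a + k * q a))
      ≤ Real.log (∑ a, Real.exp (z a)) + k * (∑ a, (softmax z a).toReal * q a)
        + k ^ 2 * D ^ 2 / 2 := by
  have hZ := sum_exp_pos z
  have h := sum_mul_exp_le (softmax z) q hD hq k
  -- The ratio of consecutive partition functions is the moment generating function of `q` under the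
  -- current softmax law.
  have h1 : ∑ a, Real.exp (z a + k * q a)
      = (∑ a, Real.exp (z a)) * ∑ a, (softmax z a).toReal * Real.exp (k * q a) := by
    rw [mul_sum]
    refine sum_congr rfl fun a _ => ?_
    rw [softmax_toReal, Real.exp_add]
    field_simp
  have h2 : 0 < ∑ a, (softmax z a).toReal * Real.exp (k * q a) := by
    have := sum_exp_pos fun a => z a + k * q a
    rw [h1] at this
    exact pos_of_mul_pos_right this hZ.le
  rw [h1, Real.log_mul hZ.ne' h2.ne', add_assoc]
  gcongr
  rw [Real.log_le_iff_le_exp h2]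
  exact h

/-- Each `z a` is below the log-partition function, hence so is any average. This replaces the
nonnegativity of a relative entropy in the exponential weights analysis. -/
theorem sum_mul_le_log_sum_exp (p : PMF A) (z : A → ℝ) :
    ∑ a, (p a).toReal * z a ≤ Real.log (∑ a, Real.exp (z a)) := by
  calc ∑ a, (p a).toReal * z a ≤ ∑ a, (p a).toReal * Real.log (∑ a, Real.exp (z a)) := by
        refine sum_le_sum fun a _ => mul_le_mul_of_nonneg_left ?_ ENNReal.toReal_nonneg
        rw [Real.le_log_iff_exp_le (sum_exp_pos z)]
        exact single_le_sum (f := fun a => Real.exp (z a)) (fun b _ => (Real.exp_pos _).le)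
          (mem_univ a)
    _ = _ := by rw [← sum_mul, sum_univ_toReal, one_mul]

end Softmax

/-! ### The inner loop -/

section InnerLoop

variable {X A : Type*} {d : ℕ}

/-- The joint law of an observation and of an action drawn from `π` in its next state. -/
def jointLaw (data : PMF (Sample X A)) (π : Policy X A) : PMF (Sample X A × A) :=
  data.bind fun w => (π w.x').map (Prod.mk w)

/-- The weight `⟨φ(X,A), V β⟩` of an observation. -/
def weight (φ : X → A → Vec d) (V : Matrix (Fin d) (Fin d) ℝ) (β : Vec d) (x : X) (a : A) : ℝ :=
  inner ℝ (φ x a) (act V β)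

/-- The stochastic gradient in `θ`. -/
def gradθ (φ : X → A → Vec d) (V : Matrix (Fin d) (Fin d) ℝ) (β : Vec d) (p : Sample X A × A) :
    Vec d :=
  weight φ V β p.1.x p.1.a • φ p.1.x' p.2 - weight φ V β p.1.x p.1.a • φ p.1.x p.1.a

/-- The inner iterate obtained from the observation and action `p`. -/
def innerNext (φ : X → A → Vec d) (V : Matrix (Fin d) (Fin d) ℝ) (Dθ : ℝ) (lr : Rates) (β : Vec d)
    (s : InnerState d) (p : Sample X A × A) : InnerState d where
  ρ := projUnit (s.ρ - lr.ξ * (1 - weight φ V β p.1.x p.1.a))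
  θ := projBall Dθ (s.θ - lr.η • gradθ φ V β p)
  sumρ := s.sumρ + s.ρ
  sumθ := s.sumθ + s.θ
  used := s.used + 1

variable (data : PMF (Sample X A)) (φ : X → A → Vec d) (V : Matrix (Fin d) (Fin d) ℝ)
  (Dθ : ℝ) (lr : Rates) (π : Policy X A) (β : Vec d)

/-- Separates the randomness, whose law does not depend on the state `s`, from a deterministic
update. -/
theorem innerStep_eq_map [Fintype A] [Nonempty A] (s : InnerState d) :
    innerStep data φ V Dθ lr π β s = (jointLaw data π).map (innerNext φ V Dθ lr β s) := by
  unfold innerStep jointLaw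
  rw [PMF.map_bind]
  congr 1
  funext w
  rw [PMF.map_comp]
  rfl

variable {data}

theorem finite_support_jointLaw [Finite A] (hd : data.support.Finite) :
    (jointLaw data π).support.Finite :=
  finite_support_bind hd fun _ => finite_support_map _ (Set.toFinite _)

theorem expect_jointLaw [Fintype A] (hd : data.support.Finite) (f : Sample X A × A → ℝ) :
    expect (jointLaw data π) f
      = expect data fun w => ∑ a, (π w.x' a).toReal * f (w, a) := by
  rw [jointLaw, expect_bind hd fun _ => finite_support_map _ (Set.toFinite _)]
  congr 1
  funext w
  rw [expect_map (Set.toFinite _), expect_fintype]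

variable [Fintype A] [Nonempty A]

theorem finite_support_innerStep (hd : data.support.Finite) (s : InnerState d) :
    (innerStep data φ V Dθ lr π β s).support.Finite := by
  rw [innerStep_eq_map]
  exact finite_support_map _ (finite_support_jointLaw π hd)

theorem finite_support_innerLoop (hd : data.support.Finite) (k : ℕ) (s : InnerState d) :
    (innerLoop data φ V Dθ lr π β k s).support.Finite := by
  induction k with
  | zero => exact finite_support_pure s
  | succ k ih => exact finite_support_bind ih (finite_support_innerStep φ V Dθ lr π β hd)

/-- What every inner iterate satisfies after `k` iterations. -/
structure InnerInvariant (Dθ : ℝ) (n k : ℕ) (s : InnerState d) : Prop where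
  ρ_mem : s.ρ ∈ Set.Icc (0 : ℝ) 1
  θ_mem : ‖s.θ‖ ≤ Dθ
  sumρ_mem : s.sumρ ∈ Set.Icc (0 : ℝ) k
  sumθ_mem : ‖s.sumθ‖ ≤ k * Dθ
  used_eq : s.used = n + k

variable {Dθ}

theorem innerInvariant_of_mem_support (hD : 0 ≤ Dθ) {n : ℕ} {ρ₀ : ℝ} (hρ : ρ₀ ∈ Set.Icc (0 : ℝ) 1)
    {θ₀ : Vec d} (hθ : ‖θ₀‖ ≤ Dθ) (k : ℕ) :
    ∀ e ∈ (innerLoop data φ V Dθ lr π β k ⟨ρ₀, θ₀, 0, 0, n⟩).support,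
      InnerInvariant Dθ n k e := by
  induction k with
  | zero =>
    intro e he
    rw [innerLoop, PMF.support_pure, Set.mem_singleton_iff] at he
    subst he
    exact ⟨hρ, hθ, by simp, by simp, by simp⟩
  | succ k ih =>
    intro e he
    rw [innerLoop, PMF.mem_support_bind_iff] at he
    obtain ⟨s, hs, he⟩ := he
    rw [innerStep_eq_map, PMF.support_map] at he
    obtain ⟨p, -, rfl⟩ := he
    have h := ih s hs
    refine ⟨projUnit_mem _, norm_projBall_le hD _, ?_, ?_, ?_⟩
    · have h1 := h.ρ_mem
      have h2 := h.sumρ_mem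
      simp only [innerNext, Set.mem_Icc] at *
      push_cast
      constructor <;> linarith
    · have h1 := norm_add_le s.sumθ s.θ
      have h2 := h.θ_mem
      have h3 := h.sumθ_mem
      simp only [innerNext]
      push_cast
      linarith
    · simp only [innerNext, h.used_eq]
      ring

variable (Dθ) in
/-- Regret of the inner loop against fixed `ρs`, `θs`, where `gρ` and `gθ` are the exact
gradients. -/
theorem innerLoop_potential_le (hd : data.support.Finite) (hD : 0 ≤ Dθ) (hξ : 0 < lr.ξ)
    (hη : 0 < lr.η) {gρ : ℝ} {gθ : Vec d} {Gρ Gθ : ℝ}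
    (hgρ : expect (jointLaw data π) (fun p => 1 - weight φ V β p.1.x p.1.a) = gρ)
    (hgθ : ∀ y, expect (jointLaw data π) (fun p => inner ℝ (gradθ φ V β p) y) = inner ℝ gθ y)
    (hGρ : expect (jointLaw data π) (fun p => (1 - weight φ V β p.1.x p.1.a) ^ 2) ≤ Gρ)
    (hGθ : expect (jointLaw data π) (fun p => ‖gradθ φ V β p‖ ^ 2) ≤ Gθ)
    {ρs : ℝ} (hρs : ρs ∈ Set.Icc (0 : ℝ) 1) {θs : Vec d} (hθs : ‖θs‖ ≤ Dθ) (k : ℕ)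
    (s : InnerState d) :
    expect (innerLoop data φ V Dθ lr π β k s) (fun e =>
        gρ * (e.sumρ - k * ρs) + inner ℝ gθ (e.sumθ - (k : ℝ) • θs)
          + (e.ρ - ρs) ^ 2 / (2 * lr.ξ) + ‖e.θ - θs‖ ^ 2 / (2 * lr.η))
      ≤ gρ * s.sumρ + inner ℝ gθ s.sumθ
        + (s.ρ - ρs) ^ 2 / (2 * lr.ξ) + ‖s.θ - θs‖ ^ 2 / (2 * lr.η)
        + k * (lr.ξ * Gρ / 2 + lr.η * Gθ / 2) := by
  induction k with
  | zero => simp [innerLoop, expect_pure]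
  | succ k ih =>
    have hfin := finite_support_innerLoop φ V Dθ lr π β hd k s
    rw [innerLoop, expect_bind hfin (finite_support_innerStep φ V Dθ lr π β hd)]
    -- One step: the drop of the squared distances pays for the linear regret of the current
    -- iterate, up to the second moments of the gradients.
    have key : ∀ e : InnerState d,
        expect (innerStep data φ V Dθ lr π β e) (fun e =>
            gρ * (e.sumρ - (k + 1 : ℕ) * ρs) + inner ℝ gθ (e.sumθ - ((k + 1 : ℕ) : ℝ) • θs)
              + (e.ρ - ρs) ^ 2 / (2 * lr.ξ) + ‖e.θ - θs‖ ^ 2 / (2 * lr.η))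
          ≤ (gρ * (e.sumρ - k * ρs) + inner ℝ gθ (e.sumθ - (k : ℝ) • θs)
              + (e.ρ - ρs) ^ 2 / (2 * lr.ξ) + ‖e.θ - θs‖ ^ 2 / (2 * lr.η))
            + (lr.ξ * Gρ / 2 + lr.η * Gθ / 2) := by
      intro e
      have hJ := finite_support_jointLaw π hd
      rw [innerStep_eq_map, expect_map hJ]
      set B := gρ * (e.sumρ - k * ρs) + inner ℝ gθ (e.sumθ - (k : ℝ) • θs)
              + (e.ρ - ρs) ^ 2 / (2 * lr.ξ) + ‖e.θ - θs‖ ^ 2 / (2 * lr.η) with hB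
      -- The exact linear terms are kept apart from the stochastic ones; they cancel in expectation
      -- because the gradients are unbiased.
      calc _ ≤ expect (jointLaw data π) (fun p =>
            (B + gρ * (e.ρ - ρs) + inner ℝ gθ (e.θ - θs))
            - ((e.ρ - ρs) * (1 - weight φ V β p.1.x p.1.a) + inner ℝ (gradθ φ V β p) (e.θ - θs))
            + (lr.ξ / 2 * (1 - weight φ V β p.1.x p.1.a) ^ 2
              + lr.η / 2 * ‖gradθ φ V β p‖ ^ 2)) := by
            refine expect_mono hJ fun p _ => ?_
            have h1 := projUnit_step_le lr.ξ e.ρ (1 - weight φ V β p.1.x p.1.a) ρs hρs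
            have h2 := norm_projBall_step_le hD lr.η e.θ (gradθ φ V β p) θs hθs
            have h1' := div_le_div_of_nonneg_right h1 (by positivity : 0 ≤ 2 * lr.ξ)
            have h2' := div_le_div_of_nonneg_right h2 (by positivity : 0 ≤ 2 * lr.η)
            have e1 : ((e.ρ - ρs) ^ 2 - 2 * lr.ξ * ((1 - weight φ V β p.1.x p.1.a) * (e.ρ - ρs))
                + lr.ξ ^ 2 * (1 - weight φ V β p.1.x p.1.a) ^ 2) / (2 * lr.ξ)
                = (e.ρ - ρs) ^ 2 / (2 * lr.ξ) - (e.ρ - ρs) * (1 - weight φ V β p.1.x p.1.a)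
                  + lr.ξ / 2 * (1 - weight φ V β p.1.x p.1.a) ^ 2 := by
              field_simp
            have e2 : (‖e.θ - θs‖ ^ 2 - 2 * lr.η * inner ℝ (gradθ φ V β p) (e.θ - θs)
                + lr.η ^ 2 * ‖gradθ φ V β p‖ ^ 2) / (2 * lr.η)
                = ‖e.θ - θs‖ ^ 2 / (2 * lr.η) - inner ℝ (gradθ φ V β p) (e.θ - θs)
                  + lr.η / 2 * ‖gradθ φ V β p‖ ^ 2 := by
              field_simp
            rw [e1] at h1'
            rw [e2] at h2'
            -- The sums receive the iterate before its update, so the current `e.θ` is what this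
            -- step adds.
            have e3 : inner ℝ gθ (e.sumθ + e.θ - ((k + 1 : ℕ) : ℝ) • θs)
                = inner ℝ gθ (e.sumθ - (k : ℝ) • θs) + inner ℝ gθ (e.θ - θs) := by
              rw [← inner_add_right]
              congr 1
              push_cast
              rw [add_smul, one_smul]
              abel
            simp only [innerNext]
            rw [e3, hB]
            push_cast
            linarith
        _ = B + (lr.ξ / 2 * expect (jointLaw data π) (fun p =>
                  (1 - weight φ V β p.1.x p.1.a) ^ 2)
              + lr.η / 2 * expect (jointLaw data π) (fun p => ‖gradθ φ V β p‖ ^ 2)) := by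
            rw [expect_add hJ, expect_sub hJ, expect_const hJ, expect_add hJ, expect_add hJ,
              expect_mul_left, expect_mul_left, expect_mul_left, hgρ, hgθ]
            ring
        _ ≤ _ := by
            have := mul_le_mul_of_nonneg_left hGρ (by positivity : 0 ≤ lr.ξ / 2)
            have := mul_le_mul_of_nonneg_left hGθ (by positivity : 0 ≤ lr.η / 2)
            linarith
    refine (expect_mono hfin fun e _ => key e).trans ?_
    rw [expect_add hfin, expect_const hfin]
    push_cast
    linarith

variable (Dθ) in
-- The potential bound divided by `K`: final distances are dropped, and initial ones are at most the
-- diameters `1` and `2 Dθ`.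
theorem innerLoop_regret_le (hd : data.support.Finite) (hD : 0 ≤ Dθ) (hξ : 0 < lr.ξ)
    (hη : 0 < lr.η) {gρ : ℝ} {gθ : Vec d} {Gρ Gθ : ℝ}
    (hgρ : expect (jointLaw data π) (fun p => 1 - weight φ V β p.1.x p.1.a) = gρ)
    (hgθ : ∀ y, expect (jointLaw data π) (fun p => inner ℝ (gradθ φ V β p) y) = inner ℝ gθ y)
    (hGρ : expect (jointLaw data π) (fun p => (1 - weight φ V β p.1.x p.1.a) ^ 2) ≤ Gρ)
    (hGθ : expect (jointLaw data π) (fun p => ‖gradθ φ V β p‖ ^ 2) ≤ Gθ)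
    {ρs : ℝ} (hρs : ρs ∈ Set.Icc (0 : ℝ) 1) {θs : Vec d} (hθs : ‖θs‖ ≤ Dθ) {K : ℕ} (hK : 0 < K)
    {ρ₀ : ℝ} (hρ₀ : ρ₀ ∈ Set.Icc (0 : ℝ) 1) {θ₀ : Vec d} (hθ₀ : ‖θ₀‖ ≤ Dθ) (n : ℕ) :
    expect (innerLoop data φ V Dθ lr π β K ⟨ρ₀, θ₀, 0, 0, n⟩) (fun e =>
        gρ * ((1 / (K : ℝ)) * e.sumρ - ρs) + inner ℝ gθ ((1 / (K : ℝ)) • e.sumθ - θs))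
      ≤ 1 / (2 * lr.ξ * K) + 2 * Dθ ^ 2 / (lr.η * K) + lr.ξ * Gρ / 2 + lr.η * Gθ / 2 := by
  have hK' : (0 : ℝ) < K := by exact_mod_cast hK
  have hfin := finite_support_innerLoop φ V Dθ lr π β hd K ⟨ρ₀, θ₀, 0, 0, n⟩
  have h := innerLoop_potential_le φ V Dθ lr π β hd hD hξ hη hgρ hgθ hGρ hGθ hρs hθs K
    ⟨ρ₀, θ₀, 0, 0, n⟩
  have h1 : expect (innerLoop data φ V Dθ lr π β K ⟨ρ₀, θ₀, 0, 0, n⟩) (fun e =>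
        K * (gρ * ((1 / (K : ℝ)) * e.sumρ - ρs) + inner ℝ gθ ((1 / (K : ℝ)) • e.sumθ - θs)))
      ≤ expect (innerLoop data φ V Dθ lr π β K ⟨ρ₀, θ₀, 0, 0, n⟩) (fun e =>
        gρ * (e.sumρ - K * ρs) + inner ℝ gθ (e.sumθ - (K : ℝ) • θs)
          + (e.ρ - ρs) ^ 2 / (2 * lr.ξ) + ‖e.θ - θs‖ ^ 2 / (2 * lr.η)) := by
    refine expect_mono hfin fun e _ => ?_
    have e1 : (K : ℝ) * inner ℝ gθ ((1 / (K : ℝ)) • e.sumθ - θs)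
        = inner ℝ gθ (e.sumθ - (K : ℝ) • θs) := by
      rw [← real_inner_smul_right, smul_sub, smul_smul, mul_one_div_cancel hK'.ne', one_smul]
    have e2 : (K : ℝ) * (gρ * ((1 / (K : ℝ)) * e.sumρ - ρs)) = gρ * (e.sumρ - K * ρs) := by
      field_simp
    have h3 : 0 ≤ (e.ρ - ρs) ^ 2 / (2 * lr.ξ) := by positivity
    have h4 : 0 ≤ ‖e.θ - θs‖ ^ 2 / (2 * lr.η) := by positivity
    rw [mul_add, e1, e2]
    linarith
  rw [expect_mul_left] at h1
  have h5 : (ρ₀ - ρs) ^ 2 ≤ 1 := by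
    obtain ⟨a, b⟩ := hρs
    obtain ⟨a', b'⟩ := hρ₀
    nlinarith
  have h6 : ‖θ₀ - θs‖ ^ 2 ≤ 4 * Dθ ^ 2 := by
    have : ‖θ₀ - θs‖ ≤ 2 * Dθ := (norm_sub_le _ _).trans (by linarith)
    nlinarith [norm_nonneg (θ₀ - θs)]
  have h5' := div_le_div_of_nonneg_right h5 (by positivity : 0 ≤ 2 * lr.ξ)
  have h6' := div_le_div_of_nonneg_right h6 (by positivity : 0 ≤ 2 * lr.η)
  simp only [mul_zero, inner_zero_right, zero_add] at h
  refine le_of_mul_le_mul_left ?_ hK'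
  have e7 : (K : ℝ) * (1 / (2 * lr.ξ * K) + 2 * Dθ ^ 2 / (lr.η * K) + lr.ξ * Gρ / 2
      + lr.η * Gθ / 2) = 1 / (2 * lr.ξ) + 4 * Dθ ^ 2 / (2 * lr.η)
        + K * (lr.ξ * Gρ / 2 + lr.η * Gθ / 2) := by
    field_simp
    ring
  rw [e7]
  linarith

end InnerLoop

/-! ### Bellman errors and occupancy measures -/

section Bellman

variable {X A : Type*} [Fintype X] [Fintype A] {d : ℕ}

/-- `∑_a π(a|x) ⟨φ(x,a), θ⟩`. -/
def linValue (φ : X → A → Vec d) (π : Policy X A) (θ : Vec d) (x : X) : ℝ :=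
  ∑ a, (π x a).toReal * inner ℝ (φ x a) θ

/-- The expectation of `v` in the next state. -/
def MDP.next (M : MDP X A) (v : X → ℝ) (z : X × A) : ℝ :=
  ∑ x', (M.P z.1 z.2 x').toReal * v x'

/-- The Bellman error of `⟨φ, θ⟩` with gain `ρ`. -/
def MDP.bellmanError (M : MDP X A) (φ : X → A → Vec d) (π : Policy X A) (ρ : ℝ) (θ : Vec d)
    (z : X × A) : ℝ :=
  M.r z.1 z.2 + M.next (linValue φ π θ) z - inner ℝ (φ z.1 z.2) θ - ρ

/-- The state marginal. -/
def stateMarginal (μ : PMF (X × A)) (x : X) : ℝ := ∑ a, (μ (x, a)).toReal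

variable {M : MDP X A} {φ : X → A → Vec d} {π : Policy X A} {μ : PMF (X × A)}

theorem abs_sum_toReal_mul_le {α : Type*} [Fintype α] (p : PMF α) {f : α → ℝ} {D : ℝ}
    (h : ∀ a, |f a| ≤ D) : |∑ a, (p a).toReal * f a| ≤ D := by
  calc |∑ a, (p a).toReal * f a| ≤ ∑ a, (p a).toReal * D := by
        refine (abs_sum_le_sum_abs _ _).trans (sum_le_sum fun a _ => ?_)
        rw [abs_mul, abs_of_nonneg ENNReal.toReal_nonneg]
        exact mul_le_mul_of_nonneg_left (h a) ENNReal.toReal_nonneg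
    _ = D := by rw [← sum_mul, sum_univ_toReal, one_mul]

theorem abs_inner_le {D Dθ : ℝ} (hφ : ∀ x a, ‖φ x a‖ ≤ D) {θ : Vec d} (hθ : ‖θ‖ ≤ Dθ) (x : X)
    (a : A) : |inner ℝ (φ x a) θ| ≤ Dθ * D := by
  have h := abs_real_inner_le_norm (φ x a) θ
  have h1 := hφ x a
  have h2 : ‖φ x a‖ * ‖θ‖ ≤ D * Dθ :=
    mul_le_mul h1 hθ (norm_nonneg _) ((norm_nonneg _).trans h1)
  linarith

theorem stateMarginal_nonneg (μ : PMF (X × A)) (x : X) : 0 ≤ stateMarginal μ x :=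
  sum_nonneg fun _ _ => ENNReal.toReal_nonneg

theorem sum_stateMarginal (μ : PMF (X × A)) : ∑ x, stateMarginal μ x = 1 := by
  rw [← sum_univ_toReal μ, Fintype.sum_prod_type]
  rfl

theorem value_mem_Icc (M : MDP X A) (μ : PMF (X × A)) : M.value μ ∈ Set.Icc (0 : ℝ) 1 := by
  constructor
  · exact sum_nonneg fun z _ => mul_nonneg ENNReal.toReal_nonneg (M.r_nonneg _ _)
  · calc M.value μ ≤ ∑ z, (μ z).toReal :=
        sum_le_sum fun z _ => mul_le_of_le_one_right ENNReal.toReal_nonneg (M.r_le_one _ _)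
      _ = 1 := sum_univ_toReal μ

theorem linValue_sub (φ : X → A → Vec d) (π : Policy X A) (θ θ' : Vec d) (x : X) :
    linValue φ π (θ - θ') x = linValue φ π θ x - linValue φ π θ' x := by
  simp only [linValue, inner_sub_right, mul_sub, sum_sub_distrib]

theorem MDP.next_sub (M : MDP X A) (v w : X → ℝ) (z : X × A) :
    M.next (fun x => v x - w x) z = M.next v z - M.next w z := by
  simp only [MDP.next, mul_sub, sum_sub_distrib]

theorem MDP.IsOccupancy.toReal_eq (h : M.IsOccupancy π μ) (x : X) (a : A) :
    (μ (x, a)).toReal = stateMarginal μ x * (π x a).toReal := by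
  rw [h.policy x a, ENNReal.toReal_mul, ENNReal.toReal_sum fun _ _ => μ.apply_ne_top _,
    stateMarginal]

theorem MDP.IsOccupancy.sum_next (h : M.IsOccupancy π μ) (v : X → ℝ) :
    ∑ z, (μ z).toReal * M.next v z = ∑ x, stateMarginal μ x * v x := by
  have hf : ∀ x, stateMarginal μ x = ∑ z, (μ z).toReal * (M.P z.1 z.2 x).toReal := by
    intro x
    have := congrArg ENNReal.toReal (h.flow x)
    rw [ENNReal.toReal_sum fun _ _ => μ.apply_ne_top _, ENNReal.toReal_sum fun _ _ =>
      ENNReal.mul_ne_top (μ.apply_ne_top _) (PMF.apply_ne_top _ _)] at this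
    simpa only [ENNReal.toReal_mul, stateMarginal] using this
  simp only [hf, MDP.next, mul_sum, sum_mul]
  rw [sum_comm]
  exact sum_congr rfl fun x _ => sum_congr rfl fun z _ => by ring

theorem MDP.IsOccupancy.sum_inner (h : M.IsOccupancy π μ) (φ : X → A → Vec d) (θ : Vec d) :
    ∑ z, (μ z).toReal * inner ℝ (φ z.1 z.2) θ = ∑ x, stateMarginal μ x * linValue φ π θ x := by
  rw [Fintype.sum_prod_type]
  refine sum_congr rfl fun x _ => ?_
  simp only [h.toReal_eq, linValue, mul_sum, mul_assoc]

/-- The Bellman error of a realizable bias function vanishes, and its gain is `⟨μ^π, r⟩`. -/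
theorem bellmanError_eq_zero (h : M.IsOccupancy π μ) {θ : Vec d}
    (hb : M.IsBias π fun x a => inner ℝ (φ x a) θ) (z : X × A) :
    M.bellmanError φ π (M.value μ) θ z = 0 := by
  obtain ⟨ρ, -, hq⟩ := hb
  have h0 : ∀ z, M.bellmanError φ π ρ θ z = 0 := by
    intro z
    have := hq z.1 z.2
    rw [MDP.bellmanError, MDP.next]
    unfold linValue
    linarith
  -- The gain is identified by averaging the Bellman equation over `μ`: stationarity cancels the
  -- next-state term against the current one.
  have hρ : M.value μ = ρ := by
    have h1 : ∑ z, (μ z).toReal * M.bellmanError φ π ρ θ z = 0 := by simp [h0]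
    simp only [MDP.bellmanError, mul_sub, mul_add, sum_sub_distrib, sum_add_distrib] at h1
    rw [h.sum_next, h.sum_inner, ← sum_mul, sum_univ_toReal] at h1
    rw [MDP.value]
    linarith
  rw [hρ]
  exact h0 z

/-- Stationarity of `μ` removes the transition kernel. As `μ` follows `πs` while the value uses `π`,
the two `θ`-terms do not cancel; their difference is the gap charged to the policy player. -/
theorem sum_occupancy_bellmanError {πs : Policy X A} (h : M.IsOccupancy πs μ) (π : Policy X A)
    (ρ : ℝ) (θ : Vec d) :
    ∑ z, (μ z).toReal * M.bellmanError φ π ρ θ z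
      = M.value μ + ∑ x, stateMarginal μ x * linValue φ π θ x
        - ∑ z, (μ z).toReal * inner ℝ (φ z.1 z.2) θ - ρ := by
  simp only [MDP.bellmanError, mul_sub, mul_add, sum_sub_distrib, sum_add_distrib]
  rw [h.sum_next, ← sum_mul, sum_univ_toReal, one_mul, MDP.value]

/-- Rewards and transitions are linear in `φ`, and `ϱ` makes the constant `ρ` linear too. This is
what allows the dual comparator to reweight Bellman errors. -/
theorem exists_bellmanError_eq_inner (hM : M.IsLinear φ) (hϱ : ∃ ϱ : Vec d, ∀ x a,
    inner ℝ (φ x a) ϱ = (1 : ℝ)) (π : Policy X A) (ρ : ℝ) (θ : Vec d) :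
    ∃ y : Vec d, ∀ z, M.bellmanError φ π ρ θ z = inner ℝ (φ z.1 z.2) y := by
  obtain ⟨ψ, ω, hψ⟩ := hM
  obtain ⟨ϱ, hϱ⟩ := hϱ
  refine ⟨ω + ∑ x', linValue φ π θ x' • ψ x' - θ - ρ • ϱ, fun z => ?_⟩
  rw [inner_sub_right, inner_sub_right, inner_add_right, inner_sum, real_inner_smul_right, hϱ,
    MDP.bellmanError, (hψ z.1 z.2).1, MDP.next]
  simp only [(hψ z.1 z.2).2, real_inner_smul_right, mul_one]
  congr 3
  exact sum_congr rfl fun x _ => by ring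

theorem abs_bellmanError_sample_le {D Dθ : ℝ} (hφ : ∀ x a, ‖φ x a‖ ≤ D) {θ : Vec d}
    (hθ : ‖θ‖ ≤ Dθ) {ρ : ℝ} (hρ : ρ ∈ Set.Icc (0 : ℝ) 1) (z : X × A) (x' : X) :
    |M.r z.1 z.2 + linValue φ π θ x' - inner ℝ (φ z.1 z.2) θ - ρ| ≤ 1 + 2 * Dθ * D := by
  have h1 := abs_le.1 (abs_sum_toReal_mul_le (π x') fun a => abs_inner_le hφ hθ x' a)
  have h2 := abs_le.1 (abs_inner_le hφ hθ z.1 z.2)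
  have h3 := M.r_nonneg z.1 z.2
  have h4 := M.r_le_one z.1 z.2
  obtain ⟨h5, h6⟩ := hρ
  rw [abs_le, linValue]
  constructor <;> linarith

end Bellman

/-! ### Expectations over observations -/

section SampleLaw

variable {X A : Type*} [Fintype X] [Fintype A] {d : ℕ} (M : MDP X A) (μB : PMF (X × A))

theorem finite_support_sampleLaw : (M.sampleLaw μB).support.Finite :=
  finite_support_bind (Set.toFinite _) fun _ => finite_support_map _ (Set.toFinite _)

theorem expect_sampleLaw (f : Sample X A → ℝ) :
    expect (M.sampleLaw μB) f
      = ∑ z, (μB z).toReal * M.next (fun x' => f ⟨z.1, z.2, M.r z.1 z.2, x'⟩) z := by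
  rw [MDP.sampleLaw, expect_bind (Set.toFinite _) fun _ => finite_support_map _ (Set.toFinite _),
    expect_fintype]
  refine sum_congr rfl fun z _ => ?_
  rw [expect_map (Set.toFinite _), expect_fintype, MDP.next]

theorem MDP.next_const (k : ℝ) (z : X × A) : M.next (fun _ => k) z = k := by
  rw [MDP.next, ← sum_mul, sum_univ_toReal, one_mul]

theorem MDP.next_mul_left (k : ℝ) (v : X → ℝ) (z : X × A) :
    M.next (fun x => k * v x) z = k * M.next v z := by
  rw [MDP.next, MDP.next, mul_sum]
  exact sum_congr rfl fun x _ => by ring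

theorem MDP.next_mono {v w : X → ℝ} (h : ∀ x, v x ≤ w x) (z : X × A) :
    M.next v z ≤ M.next w z :=
  sum_le_sum fun x _ => mul_le_mul_of_nonneg_left (h x) ENNReal.toReal_nonneg

theorem expect_sampleLaw_fst (f : X → A → ℝ) :
    expect (M.sampleLaw μB) (fun w => f w.x w.a) = ∑ z, (μB z).toReal * f z.1 z.2 := by
  simp only [expect_sampleLaw, MDP.next_const]

variable (φ : X → A → Vec d) (V : Matrix (Fin d) (Fin d) ℝ) (π : Policy X A) (β : Vec d)

theorem expect_jointLaw_fst (f : X → A → ℝ) :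
    expect (jointLaw (M.sampleLaw μB) π) (fun p => f p.1.x p.1.a)
      = ∑ z, (μB z).toReal * f z.1 z.2 := by
  rw [expect_jointLaw π (finite_support_sampleLaw M μB)]
  simp only [← sum_mul, sum_univ_toReal, one_mul, expect_sampleLaw_fst]

theorem expect_inner_gradθ (y : Vec d) :
    expect (jointLaw (M.sampleLaw μB) π) (fun p => inner ℝ (gradθ φ V β p) y)
      = ∑ z, (μB z).toReal * (weight φ V β z.1 z.2
          * (M.next (linValue φ π y) z - inner ℝ (φ z.1 z.2) y)) := by
  rw [expect_jointLaw π (finite_support_sampleLaw M μB), expect_sampleLaw]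
  refine sum_congr rfl fun z _ => ?_
  congr 1
  rw [← MDP.next_const M (inner ℝ (φ z.1 z.2) y) z, ← MDP.next_sub, ← MDP.next_mul_left]
  congr 1
  funext x'
  simp only [gradθ, ← smul_sub, real_inner_smul_left, inner_sub_left, linValue, mul_sub,
    sum_sub_distrib]
  rw [← sum_mul, sum_univ_toReal, mul_sum, one_mul]
  congr 1
  exact sum_congr rfl fun a _ => by ring

theorem expect_gradρ_sq_le {Dβ ℓ : ℝ}
    (hw : ∑ z, (μB z).toReal * weight φ V β z.1 z.2 ^ 2 ≤ Dβ ^ 2 * ℓ) :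
    expect (jointLaw (M.sampleLaw μB) π) (fun p => (1 - weight φ V β p.1.x p.1.a) ^ 2)
      ≤ GρSq ℓ Dβ := by
  rw [expect_jointLaw_fst M μB π fun x a => (1 - weight φ V β x a) ^ 2, GρSq]
  calc ∑ z, (μB z).toReal * (1 - weight φ V β z.1 z.2) ^ 2
      ≤ ∑ z, (μB z).toReal * (2 * (1 + weight φ V β z.1 z.2 ^ 2)) := by
        refine sum_le_sum fun z _ => mul_le_mul_of_nonneg_left ?_ ENNReal.toReal_nonneg
        nlinarith [sq_nonneg (1 + weight φ V β z.1 z.2)]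
    _ = 2 * (1 + ∑ z, (μB z).toReal * weight φ V β z.1 z.2 ^ 2) := by
        simp only [mul_add, mul_one, sum_add_distrib, ← sum_mul, sum_univ_toReal, mul_sum, one_mul]
        congr 1
        exact sum_congr rfl fun z _ => by ring
    _ ≤ _ := by linarith

theorem expect_gradθ_sq_le {Dβ ℓ Dφ : ℝ}
    (hw : ∑ z, (μB z).toReal * weight φ V β z.1 z.2 ^ 2 ≤ Dβ ^ 2 * ℓ)
    (hφ : ∀ x a, ‖φ x a‖ ≤ Dφ) :
    expect (jointLaw (M.sampleLaw μB) π) (fun p => ‖gradθ φ V β p‖ ^ 2) ≤ GθSq ℓ Dφ Dβ := by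
  calc _ ≤ expect (jointLaw (M.sampleLaw μB) π) (fun p =>
        (4 * Dφ ^ 2) * weight φ V β p.1.x p.1.a ^ 2) := by
        refine expect_mono (finite_support_jointLaw π (finite_support_sampleLaw M μB))
          fun p _ => ?_
        rw [gradθ, ← smul_sub, norm_smul, mul_pow, Real.norm_eq_abs, sq_abs, mul_comm]
        refine mul_le_mul_of_nonneg_right ?_ (sq_nonneg _)
        have h1 := hφ p.1.x' p.2
        have h2 := hφ p.1.x p.1.a
        have h3 := norm_sub_le (φ p.1.x' p.2) (φ p.1.x p.1.a)
        nlinarith [norm_nonneg (φ p.1.x' p.2 - φ p.1.x p.1.a)]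
    _ = 4 * Dφ ^ 2 * ∑ z, (μB z).toReal * weight φ V β z.1 z.2 ^ 2 := by
        rw [expect_mul_left, expect_jointLaw_fst M μB π fun x a => weight φ V β x a ^ 2]
    _ ≤ 4 * Dφ ^ 2 * (Dβ ^ 2 * ℓ) := by gcongr
    _ = _ := by rw [GθSq]; ring

/-- The gap of the Lagrangian in the variables `ρ`, `θ` is linear, with the gradients that the
inner loop estimates. -/
theorem lagrangian_gap {μ : PMF (X × A)} (h : M.IsOccupancy π μ) {θs : Vec d}
    (hb : M.IsBias π fun x a => inner ℝ (φ x a) θs) (ρ : ℝ) (θ : Vec d) :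
    ρ - M.value μ + ∑ z, (μB z).toReal * (weight φ V β z.1 z.2 * M.bellmanError φ π ρ θ z)
      = (1 - ∑ z, (μB z).toReal * weight φ V β z.1 z.2) * (ρ - M.value μ)
        + ∑ z, (μB z).toReal * (weight φ V β z.1 z.2
          * (M.next (linValue φ π (θ - θs)) z - inner ℝ (φ z.1 z.2) (θ - θs))) := by
  -- Subtract the vanishing Bellman error at `θs` with gain `M.value μ`; the reward cancels.
  have h0 : ∀ z, M.bellmanError φ π ρ θ z
      = M.next (linValue φ π (θ - θs)) z - inner ℝ (φ z.1 z.2) (θ - θs) - (ρ - M.value μ) := by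
    intro z
    have h1 := bellmanError_eq_zero h hb z
    have h2 : linValue φ π (θ - θs) = fun x => linValue φ π θ x - linValue φ π θs x :=
      funext (linValue_sub φ π θ θs)
    rw [h2, MDP.next_sub, inner_sub_right]
    unfold MDP.bellmanError at *
    linarith
  set f : X × A → ℝ := fun z =>
    M.next (linValue φ π (θ - θs)) z - inner ℝ (φ z.1 z.2) (θ - θs)
  have h1 : ∑ z, (μB z).toReal * (weight φ V β z.1 z.2 * (f z - (ρ - M.value μ)))
      = ∑ z, (μB z).toReal * (weight φ V β z.1 z.2 * f z)
        - (∑ z, (μB z).toReal * weight φ V β z.1 z.2) * (ρ - M.value μ) := by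
    rw [sum_mul, ← sum_sub_distrib]
    exact sum_congr rfl fun z _ => by ring
  simp only [h0]
  rw [h1]
  ring

end SampleLaw

/-! ### The outer loop -/

section OuterLoop

variable {X A : Type*} [Fintype X] [Fintype A] {d : ℕ}

/-- The stochastic gradient in `β`. -/
def gradβ (φ : X → A → Vec d) (V : Matrix (Fin d) (Fin d) ℝ) (π : Policy X A) (ρ : ℝ) (θ : Vec d)
    (w : Sample X A) : Vec d :=
  (w.rew + linValue φ π θ w.x' - inner ℝ θ (φ w.x w.a) - ρ) • act V (φ w.x w.a)

variable {M : MDP X A} {φ : X → A → Vec d} {V : Matrix (Fin d) (Fin d) ℝ} {μB : PMF (X × A)}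

/-- One projected stochastic gradient step in `β`, in expectation. -/
theorem expect_dual_step_le {Dφ Dθ Dβ τ : ℝ} (hφ : ∀ x a, ‖φ x a‖ ≤ Dφ)
    (hV : ∀ v w, inner ℝ (act V v) w = inner ℝ v (act V w))
    (hτ : ∑ z, (μB z).toReal * ‖act V (φ z.1 z.2)‖ ^ 2 ≤ τ) (hDβ : 0 ≤ Dβ) {βs : Vec d}
    (hβs : ‖βs‖ ≤ Dβ) {ρ : ℝ} (hρ : ρ ∈ Set.Icc (0 : ℝ) 1) {θ : Vec d} (hθ : ‖θ‖ ≤ Dθ)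
    (π : Policy X A) (β : Vec d) (ζ : ℝ) :
    expect (M.sampleLaw μB) (fun w => ‖projBall Dβ (β + ζ • gradβ φ V π ρ θ w) - βs‖ ^ 2)
      ≤ ‖β - βs‖ ^ 2
        - 2 * ζ * (∑ z, (μB z).toReal * (weight φ V βs z.1 z.2 * M.bellmanError φ π ρ θ z)
            - ∑ z, (μB z).toReal * (weight φ V β z.1 z.2 * M.bellmanError φ π ρ θ z))
        + ζ ^ 2 * GβSq τ Dφ Dθ := by
  have hfin := finite_support_sampleLaw M μB
  have hg : expect (M.sampleLaw μB) (fun w => inner ℝ (gradβ φ V π ρ θ w) (βs - β))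
      = ∑ z, (μB z).toReal * (weight φ V βs z.1 z.2 * M.bellmanError φ π ρ θ z)
            - ∑ z, (μB z).toReal * (weight φ V β z.1 z.2 * M.bellmanError φ π ρ θ z) := by
    rw [expect_sampleLaw, ← sum_sub_distrib]
    refine sum_congr rfl fun z _ => ?_
    rw [← mul_sub, ← sub_mul]
    congr 1
    have h1 : weight φ V βs z.1 z.2 - weight φ V β z.1 z.2
        = inner ℝ (act V (φ z.1 z.2)) (βs - β) := by
      rw [inner_sub_right, hV, hV, weight, weight]
    rw [h1, MDP.bellmanError]
    have h2 : (fun x' => inner ℝ (gradβ φ V π ρ θ ⟨z.1, z.2, M.r z.1 z.2, x'⟩) (βs - β))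
        = fun x' => inner ℝ (act V (φ z.1 z.2)) (βs - β)
            * (linValue φ π θ x' - (inner ℝ (φ z.1 z.2) θ + ρ - M.r z.1 z.2)) := by
      funext x'
      rw [gradβ, real_inner_smul_left, real_inner_comm (φ z.1 z.2) θ]
      ring
    rw [h2, MDP.next_mul_left, MDP.next_sub, MDP.next_const]
    ring
  have hG : expect (M.sampleLaw μB) (fun w => ‖gradβ φ V π ρ θ w‖ ^ 2) ≤ GβSq τ Dφ Dθ := by
    rw [expect_sampleLaw]
    calc _ ≤ ∑ z, (μB z).toReal * ((1 + 2 * Dθ * Dφ) ^ 2 * ‖act V (φ z.1 z.2)‖ ^ 2) := by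
          refine sum_le_sum fun z _ => mul_le_mul_of_nonneg_left ?_ ENNReal.toReal_nonneg
          rw [← MDP.next_const M ((1 + 2 * Dθ * Dφ) ^ 2 * ‖act V (φ z.1 z.2)‖ ^ 2) z]
          refine MDP.next_mono M (fun x' => ?_) z
          rw [gradβ, norm_smul, mul_pow, Real.norm_eq_abs, real_inner_comm]
          gcongr
          exact abs_bellmanError_sample_le hφ hθ hρ z x'
      _ = (1 + 2 * Dθ * Dφ) ^ 2 * ∑ z, (μB z).toReal * ‖act V (φ z.1 z.2)‖ ^ 2 := by
          rw [mul_sum]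
          exact sum_congr rfl fun z _ => by ring
      _ ≤ (1 + 2 * Dθ * Dφ) ^ 2 * τ := by gcongr
      _ = _ := by rw [GβSq]; ring
  calc _ ≤ expect (M.sampleLaw μB) (fun w => ‖β - βs‖ ^ 2
        - (2 * ζ) * inner ℝ (gradβ φ V π ρ θ w) (βs - β)
        + ζ ^ 2 * ‖gradβ φ V π ρ θ w‖ ^ 2) := by
        refine expect_mono hfin fun w _ => ?_
        -- Ascent is descent along the negated gradient.
        have h := norm_projBall_step_le hDβ ζ β (-gradβ φ V π ρ θ w) βs hβs
        rw [smul_neg, sub_neg_eq_add, norm_neg, inner_neg_left, ← inner_neg_right,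
          neg_sub] at h
        exact h
    _ = ‖β - βs‖ ^ 2
        - 2 * ζ * expect (M.sampleLaw μB) (fun w => inner ℝ (gradβ φ V π ρ θ w) (βs - β))
        + ζ ^ 2 * expect (M.sampleLaw μB) (fun w => ‖gradβ φ V π ρ θ w‖ ^ 2) := by
        rw [expect_add hfin, expect_sub hfin, expect_const hfin, expect_mul_left, expect_mul_left]
    _ ≤ _ := by
        rw [hg]
        gcongr

/-- The potential of the policy player against a comparator with occupancy measure `μs`. -/
def policyPotential (φ : X → A → Vec d) (α : ℝ) (μs : PMF (X × A)) (S : Vec d) : ℝ :=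
  ∑ x, stateMarginal μs x * Real.log (∑ a, Real.exp (α * inner ℝ (φ x a) S))
    - α * ∑ z, (μs z).toReal * inner ℝ (φ z.1 z.2) S

variable [Nonempty A] {πs : Policy X A} {μs : PMF (X × A)}

/-- Allows the final potential to be dropped; the initial one is `log |A|`. -/
theorem policyPotential_nonneg (h : M.IsOccupancy πs μs) (α : ℝ) (S : Vec d) :
    0 ≤ policyPotential φ α μs S := by
  rw [policyPotential, sub_nonneg, h.sum_inner, mul_sum]
  refine sum_le_sum fun x _ => ?_
  rw [mul_left_comm]
  refine mul_le_mul_of_nonneg_left ?_ (stateMarginal_nonneg μs x)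
  refine le_trans (le_of_eq ?_) (sum_mul_le_log_sum_exp (πs x) _)
  rw [linValue, mul_sum]
  exact sum_congr rfl fun a _ => by ring

theorem policyPotential_zero (φ : X → A → Vec d) (α : ℝ) (μs : PMF (X × A)) :
    policyPotential φ α μs 0 = Real.log (Fintype.card A) := by
  simp [policyPotential, ← sum_mul, sum_stateMarginal]

/-- Hoeffding's lemma is applied at each state and averaged over the comparator's state marginal, on
which the regret is measured. -/
theorem policyPotential_add_le {Dφ Dθ : ℝ} (hφ : ∀ x a, ‖φ x a‖ ≤ Dφ) {θ : Vec d}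
    (hθ : ‖θ‖ ≤ Dθ) (hD : 0 ≤ Dθ * Dφ) (α : ℝ) (μs : PMF (X × A)) (S : Vec d) :
    policyPotential φ α μs (S + θ)
      ≤ policyPotential φ α μs S
        + α * (∑ x, stateMarginal μs x * linValue φ (softmaxPolicy φ α S) θ x
          - ∑ z, (μs z).toReal * inner ℝ (φ z.1 z.2) θ)
        + α ^ 2 * (Dθ * Dφ) ^ 2 / 2 := by
  have h1 : ∑ x, stateMarginal μs x * Real.log (∑ a, Real.exp (α * inner ℝ (φ x a) (S + θ)))
      ≤ ∑ x, stateMarginal μs x * Real.log (∑ a, Real.exp (α * inner ℝ (φ x a) S))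
        + α * ∑ x, stateMarginal μs x * linValue φ (softmaxPolicy φ α S) θ x
        + α ^ 2 * (Dθ * Dφ) ^ 2 / 2 := by
    calc _ ≤ ∑ x, stateMarginal μs x * (Real.log (∑ a, Real.exp (α * inner ℝ (φ x a) S))
          + α * linValue φ (softmaxPolicy φ α S) θ x + α ^ 2 * (Dθ * Dφ) ^ 2 / 2) := by
          refine sum_le_sum fun x _ =>
            mul_le_mul_of_nonneg_left ?_ (stateMarginal_nonneg μs x)
          simp only [inner_add_right, mul_add]
          exact log_sum_exp_step_le (fun a => α * inner ℝ (φ x a) S) (fun a => inner ℝ (φ x a) θ)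
            hD (fun a => abs_inner_le hφ hθ x a) α
      _ = _ := by
          simp only [mul_add, sum_add_distrib]
          rw [← sum_mul, sum_stateMarginal, one_mul, mul_sum]
          congr 2
          exact sum_congr rfl fun x _ => by ring
  simp only [policyPotential, inner_add_right, mul_add, sum_add_distrib] at h1 ⊢
  linarith

/-- The outer iterate obtained from the end `e` of the inner loop and the observation `w`. -/
def outerNext (φ : X → A → Vec d) (V : Matrix (Fin d) (Fin d) ℝ) (Dβ : ℝ) (lr : Rates) (K t : ℕ)
    (s : OuterState X A d) (e : InnerState d) (w : Sample X A) : OuterState X A d where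
  β := projBall Dβ (s.β + lr.ζ • gradβ φ V (softmaxPolicy φ lr.α s.sumθ)
    ((1 / (K : ℝ)) * e.sumρ) ((1 / (K : ℝ)) • e.sumθ) w)
  ρ := (1 / (K : ℝ)) * e.sumρ
  θ := (1 / (K : ℝ)) • e.sumθ
  sumθ := s.sumθ + (1 / (K : ℝ)) • e.sumθ
  hist := Function.update s.hist t (softmaxPolicy φ lr.α s.sumθ)
  used := e.used + 1

theorem outerStep_eq_bind (data : PMF (Sample X A)) (φ : X → A → Vec d)
    (V : Matrix (Fin d) (Fin d) ℝ) (Dθ Dβ : ℝ) (lr : Rates) (K t : ℕ) (s : OuterState X A d) :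
    outerStep data φ V Dθ Dβ lr K t s
      = (innerLoop data φ V Dθ lr (softmaxPolicy φ lr.α s.sumθ) s.β K
          ⟨s.ρ, s.θ, 0, 0, s.used⟩).bind fun e => data.map (outerNext φ V Dβ lr K t s e) :=
  rfl

theorem finite_support_outerStep {data : PMF (Sample X A)} (hd : data.support.Finite)
    (φ : X → A → Vec d) (V : Matrix (Fin d) (Fin d) ℝ) (Dθ Dβ : ℝ) (lr : Rates) (K t : ℕ)
    (s : OuterState X A d) : (outerStep data φ V Dθ Dβ lr K t s).support.Finite := by
  rw [outerStep_eq_bind]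
  exact finite_support_bind (finite_support_innerLoop _ _ _ _ _ _ hd _ _)
    fun _ => finite_support_map _ hd

theorem finite_support_outerLoop {data : PMF (Sample X A)} (hd : data.support.Finite)
    (φ : X → A → Vec d) (V : Matrix (Fin d) (Fin d) ℝ) (Dθ Dβ : ℝ) (lr : Rates) (K : ℕ)
    (init : Init d) (t : ℕ) : (outerLoop data φ V Dθ Dβ lr K init t).support.Finite := by
  induction t with
  | zero => exact finite_support_pure _
  | succ t ih => exact finite_support_bind ih (finite_support_outerStep hd φ V Dθ Dβ lr K t)

/-- What every outer iterate satisfies after `t` rounds. -/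
structure OuterInvariant (Dθ Dβ : ℝ) (K t : ℕ) (s : OuterState X A d) : Prop where
  β_mem : ‖s.β‖ ≤ Dβ
  ρ_mem : s.ρ ∈ Set.Icc (0 : ℝ) 1
  θ_mem : ‖s.θ‖ ≤ Dθ
  used_eq : s.used = t * (K + 1)

theorem InnerInvariant.average_ρ_mem {Dθ : ℝ} {n K : ℕ} {e : InnerState d} (hK : 0 < K)
    (h : InnerInvariant Dθ n K e) : (1 / (K : ℝ)) * e.sumρ ∈ Set.Icc (0 : ℝ) 1 := by
  have hK' : (0 : ℝ) < K := by exact_mod_cast hK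
  obtain ⟨h0, h1⟩ := h.sumρ_mem
  refine ⟨by positivity, ?_⟩
  rw [one_div_mul_eq_div, div_le_one hK']
  exact h1

theorem InnerInvariant.norm_average_θ_le {Dθ : ℝ} {n K : ℕ} {e : InnerState d} (hK : 0 < K)
    (h : InnerInvariant Dθ n K e) : ‖(1 / (K : ℝ)) • e.sumθ‖ ≤ Dθ := by
  have hK' : (0 : ℝ) < K := by exact_mod_cast hK
  rw [norm_smul, Real.norm_of_nonneg (by positivity), one_div_mul_eq_div, div_le_iff₀' hK']
  exact h.sumθ_mem

theorem outerInvariant_of_mem_support (data : PMF (Sample X A)) (φ : X → A → Vec d)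
    (V : Matrix (Fin d) (Fin d) ℝ) {Dθ Dβ : ℝ} (hDθ : 0 ≤ Dθ) (hDβ : 0 ≤ Dβ) (lr : Rates) {K : ℕ}
    (hK : 0 < K) {init : Init d} (hi : init.Feasible Dθ Dβ) (t : ℕ) :
    ∀ s ∈ (outerLoop data φ V Dθ Dβ lr K init t).support, OuterInvariant Dθ Dβ K t s := by
  induction t with
  | zero =>
    intro s hs
    rw [outerLoop, PMF.support_pure, Set.mem_singleton_iff] at hs
    subst hs
    exact ⟨hi.β_mem, hi.ρ_mem, hi.θ_mem, by simp⟩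
  | succ t ih =>
    intro s' hs'
    rw [outerLoop, PMF.mem_support_bind_iff] at hs'
    obtain ⟨s, hs, hs'⟩ := hs'
    rw [outerStep_eq_bind, PMF.mem_support_bind_iff] at hs'
    obtain ⟨e, he, hs'⟩ := hs'
    rw [PMF.support_map] at hs'
    obtain ⟨w, -, rfl⟩ := hs'
    have h := ih s hs
    have h' := innerInvariant_of_mem_support φ V lr _ s.β hDθ h.ρ_mem h.θ_mem K e he
    refine ⟨norm_projBall_le hDβ _, h'.average_ρ_mem hK, h'.norm_average_θ_le hK, ?_⟩
    simp only [outerNext, h'.used_eq, h.used_eq]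
    ring

end OuterLoop

/-! ### The regret bound -/

section Regret

variable {X A : Type*} [Fintype X] [Fintype A] [Nonempty A] {d : ℕ}

/-- The regret accumulated in `t` rounds plus the potentials of the `β`- and the policy player. -/
def regretPotential (M : MDP X A) (φ : X → A → Vec d) (occ : Policy X A → PMF (X × A))
    (μs : PMF (X × A)) (βs : Vec d) (lr : Rates) (t : ℕ) (s : OuterState X A d) : ℝ :=
  ∑ k ∈ range t, (M.value μs - M.value (occ (s.hist k))) + ‖s.β - βs‖ ^ 2 / (2 * lr.ζ)
    + policyPotential φ lr.α μs s.sumθ / lr.α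

/-- What the regret bound requires of the preconditioner `V` and of the dual comparator `βs`. -/
structure IsDualCertificate (φ : X → A → Vec d) (V : Matrix (Fin d) (Fin d) ℝ)
    (μB μs : PMF (X × A)) (Dβ τ ℓ : ℝ) (βs : Vec d) : Prop where
  symm : ∀ v w, inner ℝ (act V v) w = inner ℝ v (act V w)
  trace_le : ∑ z, (μB z).toReal * ‖act V (φ z.1 z.2)‖ ^ 2 ≤ τ
  weight_sq_le : ∀ β : Vec d, ‖β‖ ≤ Dβ →
    ∑ z, (μB z).toReal * weight φ V β z.1 z.2 ^ 2 ≤ Dβ ^ 2 * ℓ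
  norm_le : ‖βs‖ ≤ Dβ
  reweight : ∀ y, ∑ z, (μB z).toReal * (weight φ V βs z.1 z.2 * inner ℝ (φ z.1 z.2) y)
    = ∑ z, (μs z).toReal * inner ℝ (φ z.1 z.2) y

variable {M : MDP X A} {φ : X → A → Vec d} {V : Matrix (Fin d) (Fin d) ℝ} {μB : PMF (X × A)}
  {occ : Policy X A → PMF (X × A)} {πs : Policy X A} {Dφ Dθ Dβ τ ℓ : ℝ} {βs : Vec d}

/-- The part of the regret that one round contributes. -/
def roundBound (τ ℓ Dφ Dθ Dβ : ℝ) (lr : Rates) (K : ℕ) : ℝ :=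
  1 / (2 * lr.ξ * K) + 2 * Dθ ^ 2 / (lr.η * K) + lr.ζ * GβSq τ Dφ Dθ / 2
    + lr.α * Dθ ^ 2 * Dφ ^ 2 / 2 + lr.ξ * GρSq ℓ Dβ / 2 + lr.η * GθSq ℓ Dφ Dβ / 2

/-- The three-term decomposition of one round's suboptimality: the `β`-potential drops by `⟨μ*, r⟩ +
Q - ρ - U`, the policy potential over `α` grows by `Q`, both up to step-size terms, and what remains
is the Lagrangian gap that the inner loop controls. -/
theorem expect_outerStep_regretPotential_le (hM : M.IsLinear φ)
    (hϱ : ∃ ϱ : Vec d, ∀ x a, inner ℝ (φ x a) ϱ = (1 : ℝ)) (hφ : ∀ x a, ‖φ x a‖ ≤ Dφ)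
    (hDφ : 0 ≤ Dφ) (hDθ : 0 ≤ Dθ) (hDβ : 0 ≤ Dβ) (hocc : ∀ π, M.IsOccupancy π (occ π))
    (hbias : ∀ π : Policy X A, ∃ θ : Vec d, ‖θ‖ ≤ Dθ ∧ M.IsBias π fun x a => inner ℝ (φ x a) θ)
    (hcert : IsDualCertificate φ V μB (occ πs) Dβ τ ℓ βs) {lr : Rates} (hζ : 0 < lr.ζ)
    (hα : 0 < lr.α) (hξ : 0 < lr.ξ) (hη : 0 < lr.η) {K : ℕ} (hK : 0 < K) (t : ℕ)
    {s : OuterState X A d} (hs : OuterInvariant Dθ Dβ K t s) :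
    expect (outerStep (M.sampleLaw μB) φ V Dθ Dβ lr K t s)
        (regretPotential M φ occ (occ πs) βs lr (t + 1))
      ≤ regretPotential M φ occ (occ πs) βs lr t s + roundBound τ ℓ Dφ Dθ Dβ lr K := by
  have hd := finite_support_sampleLaw M μB
  set π := softmaxPolicy φ lr.α s.sumθ with hπ
  obtain ⟨θp, hθp, hbp⟩ := hbias π
  have hJ := finite_support_jointLaw π hd
  obtain ⟨gθ, hgθ⟩ := expect_inner hJ (gradθ φ V s.β)
  have hgρ : expect (jointLaw (M.sampleLaw μB) π) (fun p => 1 - weight φ V s.β p.1.x p.1.a)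
      = 1 - ∑ z, (μB z).toReal * weight φ V s.β z.1 z.2 := by
    rw [expect_sub hJ, expect_const hJ, expect_jointLaw_fst M μB π (weight φ V s.β)]
  have hw := hcert.weight_sq_le s.β hs.β_mem
  -- The comparators `M.value (occ π)` and `θp` change with the policy, but `π` and `s.β` stay fixed
  -- throughout this inner loop.
  have hinner := innerLoop_regret_le φ V Dθ lr π s.β hd hDθ hξ hη hgρ hgθ
    (expect_gradρ_sq_le M μB φ V π s.β hw) (expect_gradθ_sq_le M μB φ V π s.β hw hφ)
    (value_mem_Icc M (occ π)) hθp hK hs.ρ_mem hs.θ_mem s.used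
  have hfin := finite_support_innerLoop φ V Dθ lr π s.β hd K ⟨s.ρ, s.θ, 0, 0, s.used⟩
  rw [outerStep_eq_bind, expect_bind hfin fun _ => finite_support_map _ hd]
  have key : ∀ e ∈ (innerLoop (M.sampleLaw μB) φ V Dθ lr π s.β K
        ⟨s.ρ, s.θ, 0, 0, s.used⟩).support,
      expect ((M.sampleLaw μB).map (outerNext φ V Dβ lr K t s e))
          (regretPotential M φ occ (occ πs) βs lr (t + 1))
        ≤ (regretPotential M φ occ (occ πs) βs lr t s
            + (lr.ζ * GβSq τ Dφ Dθ / 2 + lr.α * Dθ ^ 2 * Dφ ^ 2 / 2))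
          + ((1 - ∑ z, (μB z).toReal * weight φ V s.β z.1 z.2)
              * ((1 / (K : ℝ)) * e.sumρ - M.value (occ π))
            + inner ℝ gθ ((1 / (K : ℝ)) • e.sumθ - θp)) := by
    intro e he
    have hinv := innerInvariant_of_mem_support φ V lr π s.β hDθ hs.ρ_mem hs.θ_mem K e he
    have hρ := hinv.average_ρ_mem hK
    have hθ := hinv.norm_average_θ_le hK
    set ρ : ℝ := (1 / (K : ℝ)) * e.sumρ with hρdef
    set θ : Vec d := (1 / (K : ℝ)) • e.sumθ with hθdef
    rw [expect_map hd]
    have hpot : ∀ w, regretPotential M φ occ (occ πs) βs lr (t + 1)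
          (outerNext φ V Dβ lr K t s e w)
        = (∑ k ∈ range t, (M.value (occ πs) - M.value (occ (s.hist k)))
            + (M.value (occ πs) - M.value (occ π))
            + policyPotential φ lr.α (occ πs) (s.sumθ + θ) / lr.α)
          + (1 / (2 * lr.ζ)) * ‖projBall Dβ (s.β + lr.ζ • gradβ φ V π ρ θ w) - βs‖ ^ 2 := by
      intro w
      simp only [regretPotential, outerNext, ← hρdef, ← hθdef, ← hπ]
      rw [sum_range_succ, Function.update_self]
      have : ∑ k ∈ range t, (M.value (occ πs) - M.value (occ (Function.update s.hist t π k)))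
          = ∑ k ∈ range t, (M.value (occ πs) - M.value (occ (s.hist k))) := by
        refine sum_congr rfl fun k hk => ?_
        rw [Function.update_of_ne (mem_range.1 hk).ne]
      rw [this]
      ring
    simp only [hpot]
    rw [expect_add hd, expect_const hd, expect_mul_left]
    have h1 := expect_dual_step_le (M := M) hφ hcert.symm hcert.trace_le hDβ hcert.norm_le hρ hθ π
      s.β lr.ζ
    have h1' := mul_le_mul_of_nonneg_left h1 (by positivity : 0 ≤ 1 / (2 * lr.ζ))
    have h2 := policyPotential_add_le hφ hθ (mul_nonneg hDθ hDφ) lr.α (occ πs) s.sumθ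
    have h2' := div_le_div_of_nonneg_right h2 hα.le
    obtain ⟨y, hy⟩ := exists_bellmanError_eq_inner hM hϱ π ρ θ
    -- Linearity of the Bellman error lets `βs` replace `μB` by the comparator's occupancy measure.
    have h3 : ∑ z, (μB z).toReal * (weight φ V βs z.1 z.2 * M.bellmanError φ π ρ θ z)
        = M.value (occ πs) + ∑ x, stateMarginal (occ πs) x * linValue φ π θ x
          - ∑ z, (occ πs z).toReal * inner ℝ (φ z.1 z.2) θ - ρ := by
      rw [← sum_occupancy_bellmanError (hocc πs)]
      simp only [hy]
      exact hcert.reweight y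
    have h4 := lagrangian_gap M μB φ V π s.β (hocc π) hbp ρ θ
    rw [← expect_inner_gradθ, hgθ] at h4
    rw [h3] at h1'
    rw [← hπ] at h2'
    set U := ∑ z, (μB z).toReal * (weight φ V s.β z.1 z.2 * M.bellmanError φ π ρ θ z)
    set Q := ∑ x, stateMarginal (occ πs) x * linValue φ π θ x
      - ∑ z, (occ πs z).toReal * inner ℝ (φ z.1 z.2) θ with hQ
    have e1 : 1 / (2 * lr.ζ) * (‖s.β - βs‖ ^ 2
        - 2 * lr.ζ * (M.value (occ πs) + ∑ x, stateMarginal (occ πs) x * linValue φ π θ x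
          - ∑ z, (occ πs z).toReal * inner ℝ (φ z.1 z.2) θ - ρ - U)
        + lr.ζ ^ 2 * GβSq τ Dφ Dθ)
        = ‖s.β - βs‖ ^ 2 / (2 * lr.ζ) - (M.value (occ πs) + Q - ρ - U)
          + lr.ζ * GβSq τ Dφ Dθ / 2 := by
      rw [hQ]
      field_simp
      ring
    have e2 : (policyPotential φ lr.α (occ πs) s.sumθ + lr.α * Q
        + lr.α ^ 2 * (Dθ * Dφ) ^ 2 / 2) / lr.α
        = policyPotential φ lr.α (occ πs) s.sumθ / lr.α + Q + lr.α * Dθ ^ 2 * Dφ ^ 2 / 2 := by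
      field_simp
    rw [e1] at h1'
    rw [e2] at h2'
    rw [regretPotential]
    linarith
  refine (expect_mono hfin key).trans ?_
  rw [expect_add hfin, expect_const hfin, roundBound]
  linarith

/-- The index enters `primalDual` as a natural number; merging the two pushforwards makes it range
over `Fin T`. -/
theorem primalDual_eq_bind (data : PMF (Sample X A)) (φ : X → A → Vec d)
    (V : Matrix (Fin d) (Fin d) ℝ) (Dθ Dβ : ℝ) (lr : Rates) (T K : ℕ) [NeZero T] (hT : 0 < T)
    (init : Init d) :
    primalDual data φ V Dθ Dβ lr T K hT init
      = (outerLoop data φ V Dθ Dβ lr K init T).bind fun s =>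
          (PMF.uniformOfFintype (Fin T)).map fun J : Fin T => (s.hist J.val, s.used) := by
  unfold primalDual
  congr 1
  funext s
  exact PMF.map_comp (p := PMF.uniformOfFintype (Fin T)) Fin.val fun J : ℕ => (s.hist J, s.used)

/-- The potential is telescoped over the rounds, and the uniform `J` turns the accumulated regret
into its average. -/
theorem expect_primalDual_le (hM : M.IsLinear φ)
    (hϱ : ∃ ϱ : Vec d, ∀ x a, inner ℝ (φ x a) ϱ = (1 : ℝ)) (hφ : ∀ x a, ‖φ x a‖ ≤ Dφ)
    (hDφ : 0 ≤ Dφ) (hDθ : 0 ≤ Dθ) (hDβ : 0 ≤ Dβ) (hocc : ∀ π, M.IsOccupancy π (occ π))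
    (hbias : ∀ π : Policy X A, ∃ θ : Vec d, ‖θ‖ ≤ Dθ ∧ M.IsBias π fun x a => inner ℝ (φ x a) θ)
    (hcert : IsDualCertificate φ V μB (occ πs) Dβ τ ℓ βs) {lr : Rates} (hζ : 0 < lr.ζ)
    (hα : 0 < lr.α) (hξ : 0 < lr.ξ) (hη : 0 < lr.η) {T K : ℕ} (hT : 0 < T) (hK : 0 < K)
    {init : Init d} (hi : init.Feasible Dθ Dβ) :
    expect (primalDual (M.sampleLaw μB) φ V Dθ Dβ lr T K hT init)
        (fun o => M.value (occ πs) - M.value (occ o.1))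
      ≤ regretBound τ ℓ Dφ Dθ Dβ (Real.log (Fintype.card A)) lr T K := by
  have hd := finite_support_sampleLaw M μB
  have hT' : (0 : ℝ) < T := by exact_mod_cast hT
  have hpot : ∀ t, expect (outerLoop (M.sampleLaw μB) φ V Dθ Dβ lr K init t)
      (regretPotential M φ occ (occ πs) βs lr t)
      ≤ 2 * Dβ ^ 2 / lr.ζ + Real.log (Fintype.card A) / lr.α
        + t * roundBound τ ℓ Dφ Dθ Dβ lr K := by
    intro t
    induction t with
    | zero =>
      rw [outerLoop, expect_pure, regretPotential]
      simp only [range_zero, sum_empty, policyPotential_zero]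
      have h1 : ‖init.β - βs‖ ≤ 2 * Dβ :=
        (norm_sub_le _ _).trans (by linarith [hi.β_mem, hcert.norm_le])
      have h2 : ‖init.β - βs‖ ^ 2 / (2 * lr.ζ) ≤ (2 * Dβ) ^ 2 / (2 * lr.ζ) := by gcongr
      have h3 : (2 * Dβ) ^ 2 / (2 * lr.ζ) = 2 * Dβ ^ 2 / lr.ζ := by
        ring
      rw [h3] at h2
      push_cast
      linarith
    | succ t ih =>
      have hfin := finite_support_outerLoop hd φ V Dθ Dβ lr K init t
      rw [outerLoop, expect_bind hfin (finite_support_outerStep hd φ V Dθ Dβ lr K t)]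
      refine (expect_mono hfin fun s hs =>
        expect_outerStep_regretPotential_le hM hϱ hφ hDφ hDθ hDβ hocc hbias hcert hζ hα hξ hη hK t
          (outerInvariant_of_mem_support _ φ V hDθ hDβ lr hK hi t s hs)).trans ?_
      rw [expect_add hfin, expect_const hfin]
      push_cast
      linarith
  have hfin := finite_support_outerLoop hd φ V Dθ Dβ lr K init T
  have : NeZero T := ⟨hT.ne'⟩
  rw [primalDual_eq_bind, expect_bind hfin fun _ => finite_support_map _ (Set.toFinite _)]
  have hJ : ∀ s : OuterState X A d,
      expect ((PMF.uniformOfFintype (Fin T)).map fun J : Fin T => (s.hist J.val, s.used))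
          (fun o => M.value (occ πs) - M.value (occ o.1))
        = (1 / (T : ℝ)) * ∑ k ∈ range T, (M.value (occ πs) - M.value (occ (s.hist k))) := by
    intro s
    rw [expect_map (Set.toFinite _), expect_fintype, sum_range, mul_sum]
    refine sum_congr rfl fun J _ => ?_
    simp
  have hle : expect (outerLoop (M.sampleLaw μB) φ V Dθ Dβ lr K init T) (fun s =>
        (1 / (T : ℝ)) * ∑ k ∈ range T, (M.value (occ πs) - M.value (occ (s.hist k))))
      ≤ (1 / (T : ℝ)) * expect (outerLoop (M.sampleLaw μB) φ V Dθ Dβ lr K init T)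
          (regretPotential M φ occ (occ πs) βs lr T) := by
    rw [← expect_mul_left]
    refine expect_mono hfin fun s _ => mul_le_mul_of_nonneg_left ?_ (by positivity)
    have h1 : 0 ≤ policyPotential φ lr.α (occ πs) s.sumθ / lr.α :=
      div_nonneg (policyPotential_nonneg (hocc πs) _ _) hα.le
    have h2 : 0 ≤ ‖s.β - βs‖ ^ 2 / (2 * lr.ζ) := by positivity
    rw [regretPotential]
    linarith
  simp only [hJ]
  refine hle.trans ((mul_le_mul_of_nonneg_left (hpot T) (by positivity)).trans (le_of_eq ?_))
  rw [regretBound, roundBound]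
  field_simp
  ring

theorem used_of_mem_support_primalDual (data : PMF (Sample X A)) (φ : X → A → Vec d)
    (V : Matrix (Fin d) (Fin d) ℝ) (hDθ : 0 ≤ Dθ) (hDβ : 0 ≤ Dβ) (lr : Rates) {T K : ℕ}
    (hT : 0 < T) (hK : 0 < K) {init : Init d} (hi : init.Feasible Dθ Dβ) :
    ∀ o ∈ (primalDual data φ V Dθ Dβ lr T K hT init).support, o.2 = T * (K + 1) := by
  intro o ho
  rw [primalDual, PMF.mem_support_bind_iff] at ho
  obtain ⟨s, hs, ho⟩ := ho
  rw [PMF.support_map] at ho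
  obtain ⟨J, -, rfl⟩ := ho
  exact (outerInvariant_of_mem_support data φ V hDθ hDβ lr hK hi T s hs).used_eq

end Regret

/-! ### Tuning -/

section Tuning

/-- The optimal constant step size balances the two terms of a gradient descent bound. -/
theorem tuned_step_eq {a G n : ℝ} (ha : 0 < a) (hG : 0 < G) (hn : 0 < n) :
    a ^ 2 / (2 * (a / (√G * √n)) * n) + a / (√G * √n) * G / 2 = a * √G / √n := by
  have h1 : 0 < √G := Real.sqrt_pos.2 hG
  have h2 : 0 < √n := Real.sqrt_pos.2 hn
  have h3 : √G ^ 2 = G := Real.sq_sqrt hG.le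
  have h4 : √n ^ 2 = n := Real.sq_sqrt hn.le
  nth_rewrite 3 [← h3]
  nth_rewrite 2 [← h4]
  field_simp
  ring

/-- From `(x + y)² ≤ 2 (x² + y²)`. -/
theorem add_le_half_of_sq_add_sq_le {x y ε : ℝ} (hε : 0 ≤ ε) (h : x ^ 2 + y ^ 2 ≤ ε ^ 2 / 8) :
    x + y ≤ ε / 2 := by
  refine le_of_sq_le_sq ?_ (by positivity)
  nlinarith [sq_nonneg (x - y)]

variable {τ ℓ Dφ Dθ Dβ L ε : ℝ}

/-- The squares of the two balanced values `a√G/√n` and `b√H/√n` add up to `N/n`, which explains the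
form of `outerConst` and `innerConst`. -/
theorem tuned_pair_le {a b G H n N : ℝ} (ha : 0 < a) (hb : 0 < b) (hG : 0 < G) (hH : 0 < H)
    (hn : 0 < n) (hε : 0 ≤ ε) (hN : a ^ 2 * G + b ^ 2 * H = N) (h : N / n ≤ ε ^ 2 / 8) :
    (a ^ 2 / (2 * (a / (√G * √n)) * n) + a / (√G * √n) * G / 2)
      + (b ^ 2 / (2 * (b / (√H * √n)) * n) + b / (√H * √n) * H / 2) ≤ ε / 2 := by
  rw [tuned_step_eq ha hG hn, tuned_step_eq hb hH hn]
  refine add_le_half_of_sq_add_sq_le hε (le_trans (le_of_eq ?_) h)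
  rw [div_pow, div_pow, mul_pow, mul_pow, Real.sq_sqrt hG.le, Real.sq_sqrt hH.le,
    Real.sq_sqrt hn.le, ← hN]
  ring

theorem tunedRates_pos (hτ : 0 < τ) (hℓ : 0 < ℓ) (hφ : 0 < Dφ) (hθ : 0 < Dθ) (hβ : 0 < Dβ)
    (hL : 0 < L) {T K : ℕ} (hT : 0 < T) (hK : 0 < K) :
    0 < (tunedRates τ ℓ Dφ Dθ Dβ L T K).ζ ∧ 0 < (tunedRates τ ℓ Dφ Dθ Dβ L T K).α ∧
      0 < (tunedRates τ ℓ Dφ Dθ Dβ L T K).ξ ∧ 0 < (tunedRates τ ℓ Dφ Dθ Dβ L T K).η := by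
  have hT' : (0 : ℝ) < T := by exact_mod_cast hT
  have hK' : (0 : ℝ) < K := by exact_mod_cast hK
  refine ⟨?_, ?_, ?_, ?_⟩ <;> simp only [tunedRates, GβSq, GρSq, GθSq] <;> positivity

theorem regretBound_tuned_le (hτ : 0 < τ) (hℓ : 0 < ℓ) (hφ : 0 < Dφ) (hθ : 0 < Dθ) (hβ : 0 < Dβ)
    (hL : 0 < L) (hε : 0 ≤ ε) {T K : ℕ} (hT : 0 < T) (hK : 0 < K)
    (h1 : outerConst τ Dφ Dθ Dβ L / T ≤ ε ^ 2 / 8) (h2 : innerConst ℓ Dφ Dθ Dβ / K ≤ ε ^ 2 / 8) :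
    regretBound τ ℓ Dφ Dθ Dβ L (tunedRates τ ℓ Dφ Dθ Dβ L T K) T K ≤ ε := by
  have hT' : (0 : ℝ) < T := by exact_mod_cast hT
  have hK' : (0 : ℝ) < K := by exact_mod_cast hK
  have hGβ : 0 < GβSq τ Dφ Dθ := by unfold GβSq; positivity
  have hGρ : 0 < GρSq ℓ Dβ := by unfold GρSq; positivity
  have hGθ : 0 < GθSq ℓ Dφ Dβ := by unfold GθSq; positivity
  have hL2 : √(2 * L) ^ 2 = 2 * L := Real.sq_sqrt (by positivity)
  have hD : √((Dθ * Dφ) ^ 2) = Dθ * Dφ := Real.sqrt_sq (by positivity)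
  -- The eight terms form four pairs: `β` and the policy over `T` rounds, then `ρ` and `θ` over `K`
  -- iterations. Here `a` is a diameter, except for the policy, where `b² = 2L`.
  have h3 := tuned_pair_le (a := 2 * Dβ) (b := √(2 * L)) (H := (Dθ * Dφ) ^ 2) (by positivity)
    (by positivity) hGβ (by positivity) hT' hε (by rw [hL2, outerConst]; ring) h1
  have h4 := tuned_pair_le (a := 1) (b := 2 * Dθ) one_pos (by positivity) hGρ hGθ hK' hε
    (by rw [innerConst]; ring) h2
  rw [hL2, hD] at h3
  have h5 := add_le_add h3 h4
  rw [add_halves] at h5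
  refine le_trans (le_of_eq ?_) h5
  simp only [regretBound, tunedRates]
  have e1 : ∀ x y : ℝ, (2 * x) ^ 2 / (2 * y) = 2 * x ^ 2 / y := fun x y => by
    ring
  have e2 : ∀ x y : ℝ, 2 * x / (2 * y) = x / y := fun x y => by
    ring
  simp only [mul_assoc (2 : ℝ) (_ / _), e1, e2]
  ring

/-- Lower-order terms are absorbed into the leading product. The lower bound `0.69 < log 2` on `L`
gives `36 + 2L ≤ 60L`. -/
theorem outerConst_le (hτβ : 1 ≤ Dβ ^ 2 * τ) (hp : 1 ≤ Dθ * Dφ) (hL : 0.69 ≤ L) :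
    outerConst τ Dφ Dθ Dβ L ≤ 60 * ((Dθ * Dφ) ^ 2 * (Dβ ^ 2 * τ) * L) := by
  have e : outerConst τ Dφ Dθ Dβ L
      = 4 * (Dβ ^ 2 * τ) * (1 + 2 * (Dθ * Dφ)) ^ 2 + 2 * (Dθ * Dφ) ^ 2 * L := by
    rw [outerConst, GβSq]
    ring
  rw [e]
  set p := Dθ * Dφ
  set b := Dβ ^ 2 * τ
  have h1 : (1 + 2 * p) ^ 2 ≤ 9 * p ^ 2 := by nlinarith
  have hp2 : 0 < p ^ 2 := by positivity
  calc 4 * b * (1 + 2 * p) ^ 2 + 2 * p ^ 2 * L ≤ 4 * b * (9 * p ^ 2) + 2 * p ^ 2 * L * b := by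
        refine add_le_add (by gcongr) (le_mul_of_one_le_right ?_ hτβ)
        exact mul_nonneg (by positivity) (by linarith)
    _ = p ^ 2 * b * (36 + 2 * L) := by ring
    _ ≤ p ^ 2 * b * (60 * L) := by
        gcongr
        linarith
    _ = _ := by ring

theorem innerConst_le (hℓβ : 1 ≤ Dβ ^ 2 * ℓ) (hp : 1 ≤ Dθ * Dφ) :
    innerConst ℓ Dφ Dθ Dβ ≤ 20 * ((Dθ * Dφ) ^ 2 * (Dβ ^ 2 * ℓ)) := by
  have e : innerConst ℓ Dφ Dθ Dβ
      = 2 + 2 * (Dβ ^ 2 * ℓ) + 16 * ((Dθ * Dφ) ^ 2 * (Dβ ^ 2 * ℓ)) := by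
    rw [innerConst, GρSq, GθSq]
    ring
  rw [e]
  have h : Dβ ^ 2 * ℓ ≤ (Dθ * Dφ) ^ 2 * (Dβ ^ 2 * ℓ) :=
    le_mul_of_one_le_left (by linarith) (one_le_pow₀ hp)
  linarith

/-- The constant in the sample complexity bound. -/
def sampleConst : ℝ := 200000

/-- The analysis of the tuned parameters. -/
theorem tuned_spec (hτβ : 1 ≤ Dβ ^ 2 * τ) (hℓβ : 1 ≤ Dβ ^ 2 * ℓ) (hp : 1 ≤ Dθ * Dφ)
    (hL : 0.69 ≤ L) (hε : 0 < ε) (hε1 : ε ≤ 1) {T K : ℕ}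
    (hT : T = tunedT τ Dφ Dθ Dβ L ε) (hK : K = tunedK τ ℓ Dφ Dθ Dβ L T) :
    0 < T ∧ 0 < K ∧ outerConst τ Dφ Dθ Dβ L / T ≤ ε ^ 2 / 8 ∧
      innerConst ℓ Dφ Dθ Dβ / K ≤ ε ^ 2 / 8 ∧
      ((T * (K + 1) : ℕ) : ℝ)
        ≤ sampleConst * (ε⁻¹ ^ 4 * Dθ ^ 4 * Dφ ^ 4 * Dβ ^ 4 * τ * ℓ * L) := by
  have hN1 := outerConst_le hτβ hp hL
  have hN2 := innerConst_le hℓβ hp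
  have hp2 : 1 ≤ (Dθ * Dφ) ^ 2 := one_le_pow₀ hp
  have hN1' : 1 ≤ outerConst τ Dφ Dθ Dβ L := by
    have e : outerConst τ Dφ Dθ Dβ L
        = 4 * (Dβ ^ 2 * τ) * (1 + 2 * (Dθ * Dφ)) ^ 2 + 2 * (Dθ * Dφ) ^ 2 * L := by
      rw [outerConst, GβSq]
      ring
    have h1 : 0 ≤ 4 * (Dβ ^ 2 * τ) * (1 + 2 * (Dθ * Dφ)) ^ 2 := by positivity
    have h2 : 1 * 0.69 ≤ (Dθ * Dφ) ^ 2 * L := mul_le_mul hp2 hL (by norm_num) (by positivity)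
    rw [e]
    linarith
  have hN2' : 2 ≤ innerConst ℓ Dφ Dθ Dβ := by
    have e : innerConst ℓ Dφ Dθ Dβ
        = 2 + 2 * (Dβ ^ 2 * ℓ) + 16 * ((Dθ * Dφ) ^ 2 * (Dβ ^ 2 * ℓ)) := by
      rw [innerConst, GρSq, GθSq]
      ring
    rw [e]
    have : 0 ≤ 2 * (Dβ ^ 2 * ℓ) + 16 * ((Dθ * Dφ) ^ 2 * (Dβ ^ 2 * ℓ)) := by positivity
    linarith
  rw [tunedT] at hT
  rw [tunedK] at hK
  set N₁ := outerConst τ Dφ Dθ Dβ L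
  set N₂ := innerConst ℓ Dφ Dθ Dβ
  have hN1pos : 0 < N₁ := by linarith
  have hN2pos : 0 < N₂ := by linarith
  have hTlow : 8 * N₁ / ε ^ 2 ≤ T := hT ▸ Nat.le_ceil _
  have hTup : (T : ℝ) < 8 * N₁ / ε ^ 2 + 1 := hT ▸ Nat.ceil_lt_add_one (by positivity)
  have hKlow : (T : ℝ) * (N₂ / N₁) ≤ K := hK ▸ Nat.le_ceil _
  have hKup : (K : ℝ) < (T : ℝ) * (N₂ / N₁) + 1 := hK ▸ Nat.ceil_lt_add_one (by positivity)
  have hTpos : (0 : ℝ) < T := lt_of_lt_of_le (by positivity) hTlow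
  have hKpos : (0 : ℝ) < K := lt_of_lt_of_le (by positivity) hKlow
  have hε2 : ε ^ 2 ≤ 1 := pow_le_one₀ hε.le hε1
  have h1 : N₁ / T ≤ ε ^ 2 / 8 := by
    rw [div_le_iff₀ (by positivity)] at hTlow
    rw [div_le_div_iff₀ hTpos (by norm_num)]
    linarith
  have h2 : N₂ / K ≤ N₁ / T := by
    rw [mul_div_assoc', div_le_iff₀ hN1pos] at hKlow
    rw [div_le_div_iff₀ hKpos hTpos]
    linarith
  refine ⟨by exact_mod_cast hTpos, by exact_mod_cast hKpos, h1, h2.trans h1, ?_⟩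
  -- As `N₁ ≥ 1 ≥ ε²`, rounding up costs at most `N₁/ε²`.
  have hT9 : (T : ℝ) ≤ 9 * N₁ / ε ^ 2 := by
    have : 1 ≤ N₁ / ε ^ 2 := by
      rw [le_div_iff₀ (by positivity)]
      linarith
    have e : 9 * N₁ / ε ^ 2 = 8 * N₁ / ε ^ 2 + N₁ / ε ^ 2 := by ring
    linarith
  have hT8 : 8 ≤ (T : ℝ) / N₁ := by
    rw [le_div_iff₀ hN1pos]
    refine le_trans ?_ hTlow
    rw [le_div_iff₀ (by positivity)]
    nlinarith
  -- Since `T/N₁ ≥ 8` and `N₂ ≥ 2`, the main term exceeds the `2` lost to the ceiling and to the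
  -- extra sample per round.
  have hK2 : (K : ℝ) + 1 ≤ 2 * ((T : ℝ) / N₁ * N₂) := by
    have e : (T : ℝ) * (N₂ / N₁) = (T : ℝ) / N₁ * N₂ := by ring
    rw [e] at hKup
    nlinarith
  push_cast
  calc (T : ℝ) * (K + 1) ≤ T * (2 * ((T : ℝ) / N₁ * N₂)) := by gcongr
    _ = 2 * ((T : ℝ) ^ 2 / N₁ * N₂) := by ring
    _ ≤ 2 * ((9 * N₁ / ε ^ 2) ^ 2 / N₁ * N₂) := by gcongr
    _ = 162 * ε⁻¹ ^ 4 * (N₁ * N₂) := by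
        field_simp
        norm_num
    _ ≤ 162 * ε⁻¹ ^ 4 * (60 * ((Dθ * Dφ) ^ 2 * (Dβ ^ 2 * τ) * L)
          * (20 * ((Dθ * Dφ) ^ 2 * (Dβ ^ 2 * ℓ)))) := by gcongr
    _ = 194400 * (ε⁻¹ ^ 4 * Dθ ^ 4 * Dφ ^ 4 * Dβ ^ 4 * τ * ℓ * L) := by ring
    _ ≤ _ := by
        have e : ε⁻¹ ^ 4 * Dθ ^ 4 * Dφ ^ 4 * Dβ ^ 4 * τ * ℓ * L
            = ε⁻¹ ^ 4 * (Dθ * Dφ) ^ 4 * (Dβ ^ 2 * τ) * (Dβ ^ 2 * ℓ) * L := by ring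
        rw [sampleConst, e]
        gcongr
        norm_num

end Tuning

/-! ### The method with preconditioner `Λ^{c-1}` -/

section Run

variable {X A : Type*} [Fintype X] [Fintype A] {d : ℕ} {M : MDP X A} {φ : X → A → Vec d}
  {μB μs : PMF (X × A)} {c Dφ Dθ Dβ τ ℓ : ℝ}

theorem exists_isDualCertificate (hc : c = 1 / 2 ∨ c = 1) (hu : IsUnit (covariance φ μB))
    (hDβ : 0 ≤ Dβ) (hcov : coverage φ c μs μB ≤ Dβ ^ 2)
    (hτ : (covariance φ μB ^ (2 * c - 1)).trace ≤ τ)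
    (hℓ : specNorm (covariance φ μB) ^ (2 * c - 1) ≤ ℓ) :
    ∃ βs, IsDualCertificate φ (covariance φ μB ^ (c - 1)) μB μs Dβ τ ℓ βs := by
  obtain ⟨βs, hβs, hre⟩ := exists_dual_comparator φ μB hu c μs
  refine ⟨βs, inner_act_comm CFC.rpow_nonneg, (sum_norm_act_rpow_sq φ μB hu c).trans_le hτ,
    fun β hβ => ?_, le_of_sq_le_sq (hβs.trans_le hcov) hDβ, hre⟩
  refine (sum_inner_act_rpow_sq_le φ μB hu hc β).trans ?_
  have := Real.rpow_nonneg (specNorm_nonneg (covariance φ μB)) (2 * c - 1)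
  gcongr

/-- The coverage ratio cannot be small: `1 ≤ D_β² ℓ`. -/
theorem IsDualCertificate.one_le {V : Matrix (Fin d) (Fin d) ℝ} {βs : Vec d}
    (h : IsDualCertificate φ V μB μs Dβ τ ℓ βs)
    (hϱ : ∃ ϱ : Vec d, ∀ x a, inner ℝ (φ x a) ϱ = (1 : ℝ)) : 1 ≤ Dβ ^ 2 * ℓ := by
  obtain ⟨ϱ, hϱ⟩ := hϱ
  -- Testing with `ϱ` shows that the weights have `μB`-mean one; their variance is nonnegative, so
  -- their second moment is at least one.
  have h1 := h.reweight ϱ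
  simp only [hϱ, mul_one, sum_univ_toReal] at h1
  refine le_trans ?_ (h.weight_sq_le βs h.norm_le)
  have h2 : 0 ≤ ∑ z, (μB z).toReal * (weight φ V βs z.1 z.2 - 1) ^ 2 :=
    sum_nonneg fun z _ => mul_nonneg ENNReal.toReal_nonneg (sq_nonneg _)
  have h3 : ∑ z, (μB z).toReal * (weight φ V βs z.1 z.2 - 1) ^ 2
      = ∑ z, (μB z).toReal * weight φ V βs z.1 z.2 ^ 2
        - 2 * ∑ z, (μB z).toReal * weight φ V βs z.1 z.2 + ∑ z, (μB z).toReal := by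
    rw [mul_sum, ← sum_sub_distrib, ← sum_add_distrib]
    exact sum_congr rfl fun z _ => by ring
  rw [h3, h1, sum_univ_toReal] at h2
  linarith

/-- Gives `ℓ ≤ τ`, so that `1 ≤ Dβ² ℓ` passes to `τ`. At `c = 1/2` it reads `1 ≤ d`. -/
theorem specNorm_rpow_le_trace_rpow (hc : c = 1 / 2 ∨ c = 1) (hd : 1 ≤ d) :
    specNorm (covariance φ μB) ^ (2 * c - 1) ≤ (covariance φ μB ^ (2 * c - 1)).trace := by
  rcases hc with rfl | rfl
  · rw [show (2 * (1 / 2 : ℝ) - 1) = 0 by norm_num, CFC.rpow_zero _ (covariance_nonneg φ μB),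
      Real.rpow_zero, Matrix.trace_one, Fintype.card_fin]
    exact_mod_cast hd
  · rw [show (2 * (1 : ℝ) - 1) = 1 by norm_num, CFC.rpow_one _ (covariance_nonneg φ μB),
      Real.rpow_one]
    exact specNorm_covariance_le_trace φ μB

theorem trace_rpow_le (hc : c = 1 / 2 ∨ c = 1) (hφ : ∀ x a, ‖φ x a‖ ≤ Dφ) :
    (covariance φ μB ^ (2 * c - 1)).trace ≤ Dφ ^ (2 * (2 * c - 1)) * (d : ℝ) ^ (2 - 2 * c) := by
  rcases hc with rfl | rfl
  · norm_num [CFC.rpow_zero _ (covariance_nonneg φ μB)]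
  · norm_num [CFC.rpow_one _ (covariance_nonneg φ μB)]
    exact trace_covariance_le φ μB hφ

theorem specNorm_rpow_le_bound (hc : c = 1 / 2 ∨ c = 1) (hφ : ∀ x a, ‖φ x a‖ ≤ Dφ) :
    specNorm (covariance φ μB) ^ (2 * c - 1) ≤ Dφ ^ (2 * (2 * c - 1)) := by
  rcases hc with rfl | rfl
  · norm_num
  · norm_num
    exact (specNorm_covariance_le_trace φ μB).trans (trace_covariance_le φ μB hφ)

variable [Nonempty A] {occ : Policy X A → PMF (X × A)} {πB πs : Policy X A}

/-- The tuned method, for any upper bounds `τ` and `ℓ`. -/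
theorem tuned_run_le (hc : c = 1 / 2 ∨ c = 1) (hM : M.IsLinear φ)
    (hϱ : ∃ ϱ : Vec d, ∀ x a, inner ℝ (φ x a) ϱ = (1 : ℝ)) (hφ : ∀ x a, ‖φ x a‖ ≤ Dφ)
    (hDφ : 0 ≤ Dφ) (hDθ : 0 ≤ Dθ) (hDβ : 0 ≤ Dβ) (hocc : ∀ π, M.IsOccupancy π (occ π))
    (hbias : ∀ π : Policy X A, ∃ θ : Vec d, ‖θ‖ ≤ Dθ ∧ M.IsBias π fun x a => inner ℝ (φ x a) θ)
    (hu : IsUnit (covariance φ (occ πB))) (hcov : coverage φ c (occ πs) (occ πB) ≤ Dβ ^ 2)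
    (hτ : (covariance φ (occ πB) ^ (2 * c - 1)).trace ≤ τ)
    (hℓ : specNorm (covariance φ (occ πB)) ^ (2 * c - 1) ≤ ℓ) (hℓτ : ℓ ≤ τ) {ε : ℝ} (hε : 0 < ε)
    (hε1 : ε ≤ 1) (hA : 2 ≤ Fintype.card A) (hp : 1 ≤ Dθ * Dφ) {T K : ℕ}
    (hT : T = tunedT τ Dφ Dθ Dβ (Real.log (Fintype.card A)) ε)
    (hK : K = tunedK τ ℓ Dφ Dθ Dβ (Real.log (Fintype.card A)) T) :
    (∃ hT : 0 < T, ∀ init : Init d, init.Feasible Dθ Dβ →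
      expect (M.run φ c (occ πB) Dθ Dβ
          (tunedRates τ ℓ Dφ Dθ Dβ (Real.log (Fintype.card A)) T K) T K hT init)
        (fun o => M.value (occ πs) - M.value (occ o.1)) ≤ ε) ∧
    ((T * (K + 1) : ℕ) : ℝ) ≤ sampleConst
      * (ε⁻¹ ^ 4 * Dθ ^ 4 * Dφ ^ 4 * Dβ ^ 4 * τ * ℓ * Real.log (Fintype.card A)) := by
  obtain ⟨βs, hcert⟩ := exists_isDualCertificate hc hu hDβ hcov hτ hℓ
  have hℓβ := hcert.one_le hϱ
  have hτβ : 1 ≤ Dβ ^ 2 * τ := hℓβ.trans (mul_le_mul_of_nonneg_left hℓτ (sq_nonneg _))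
  have hL : 0.69 ≤ Real.log (Fintype.card A) := by
    have h2 : Real.log 2 ≤ Real.log (Fintype.card A) :=
      Real.log_le_log (by norm_num) (by exact_mod_cast hA)
    linarith [Real.log_two_gt_d9]
  obtain ⟨hT0, hK0, h1, h2, hn⟩ := tuned_spec hτβ hℓβ hp hL hε hε1 hT hK
  refine ⟨⟨hT0, fun init hi => ?_⟩, hn⟩
  -- Positivity of `Dβ` and `ℓ` comes from `1 ≤ Dβ² ℓ`, that of `Dθ` and `Dφ` from `1 ≤ Dθ Dφ`.
  have hβpos : 0 < Dβ := by
    refine lt_of_le_of_ne hDβ fun h => ?_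
    rw [← h] at hℓβ
    norm_num at hℓβ
  have hℓpos : 0 < ℓ := pos_of_mul_pos_right (by linarith) (sq_nonneg Dβ)
  have hθpos : 0 < Dθ := pos_of_mul_pos_left (by linarith) hDφ
  have hφpos : 0 < Dφ := pos_of_mul_pos_right (by linarith) hDθ
  have hτpos : 0 < τ := hℓpos.trans_le hℓτ
  have hLpos : 0 < Real.log (Fintype.card A) := by linarith
  obtain ⟨hζ, hα, hξ, hη⟩ := tunedRates_pos hτpos hℓpos hφpos hθpos hβpos hLpos hT0 hK0
  exact (expect_primalDual_le hM hϱ hφ hDφ hDθ hDβ hocc hbias hcert hζ hα hξ hη hT0 hK0 hi).trans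
    (regretBound_tuned_le hτpos hℓpos hφpos hθpos hβpos hLpos hε.le hT0 hK0 h1 h2)

end Run

end AvgReward

end

/-! ### The main theorem, with both tunings -/

theorem theorem2 :
    ∃ C : ℝ, 0 < C ∧
      ∀ (X : Type*) (A : Type*) [Fintype X] [Fintype A] [Nonempty A] (d : ℕ)
        (M : MDP X A) (φ : X → A → Vec d) (c Dφ Dθ Dβ : ℝ) (πB πs : Policy X A)
        (occ : Policy X A → PMF (X × A)),
        (c = 1 / 2 ∨ c = 1) →
        M.IsLinear φ →
        (∃ ϱ : Vec d, ∀ x a, inner ℝ (φ x a) ϱ = 1) →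
        (∀ x a, ‖φ x a‖ ≤ Dφ) →
        -- `occ π` is the occupancy measure of `π` (any choice of one, should it not be unique)
        (∀ π, M.IsOccupancy π (occ π)) →
        -- every policy has a bias function that is realizable in the ball of radius `Dθ`
        (∀ π : Policy X A, ∃ θ : Vec d, ‖θ‖ ≤ Dθ ∧ M.IsBias π fun x a => inner ℝ (φ x a) θ) →
        IsUnit (covariance φ (occ πB)) →
        0 ≤ Dβ →
        coverage φ c (occ πs) (occ πB) ≤ Dβ ^ 2 →
        -- the regret bound for arbitrary learning rates, and the number of samples used
        (∀ (lr : Rates) (T K : ℕ) (hT : 0 < T) (init : Init d),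
          0 < lr.ζ → 0 < lr.α → 0 < lr.ξ → 0 < lr.η → 0 < K → init.Feasible Dθ Dβ →
          expect (M.run φ c (occ πB) Dθ Dβ lr T K hT init)
              (fun o => M.value (occ πs) - M.value (occ o.1))
            ≤ regretBound ((covariance φ (occ πB) ^ (2 * c - 1)).trace)
                (specNorm (covariance φ (occ πB)) ^ (2 * c - 1))
                Dφ Dθ Dβ (Real.log (Fintype.card A)) lr T K
          ∧ ∀ o ∈ (M.run φ c (occ πB) Dθ Dβ lr T K hT init).support, o.2 = T * (K + 1)) ∧
        -- the sample complexity of the tuned method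
        (∀ ε : ℝ, 0 < ε → ε ≤ 1 → 2 ≤ Fintype.card A → 1 ≤ Dθ * Dφ →
          -- tuning in terms of `Λ`
          (∀ (τ ℓ : ℝ) (T K : ℕ),
            τ = (covariance φ (occ πB) ^ (2 * c - 1)).trace →
            ℓ = specNorm (covariance φ (occ πB)) ^ (2 * c - 1) →
            T = tunedT τ Dφ Dθ Dβ (Real.log (Fintype.card A)) ε →
            K = tunedK τ ℓ Dφ Dθ Dβ (Real.log (Fintype.card A)) T →
            (∃ hT : 0 < T, ∀ init : Init d, init.Feasible Dθ Dβ →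
              expect (M.run φ c (occ πB) Dθ Dβ
                  (tunedRates τ ℓ Dφ Dθ Dβ (Real.log (Fintype.card A)) T K) T K hT init)
                (fun o => M.value (occ πs) - M.value (occ o.1)) ≤ ε) ∧
            ((T * (K + 1) : ℕ) : ℝ)
              ≤ C * (ε⁻¹ ^ 4 * Dθ ^ 4 * Dφ ^ 4 * Dβ ^ 4 * τ * ℓ * Real.log (Fintype.card A)) ∧
            (1 ≤ specNorm (covariance φ (occ πB)) →
              ((T * (K + 1) : ℕ) : ℝ)
                ≤ C * (ε⁻¹ ^ 4 * Dθ ^ 4 * Dφ ^ 4 * Dβ ^ 4 * τ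
                    * specNorm (covariance φ (occ πB)) ^ (2 * (2 * c - 1))
                    * Real.log (Fintype.card A)))) ∧
          -- tuning in terms of `Dφ` and `d` only, without knowledge of `Λ`
          (1 ≤ Dφ → ∀ (τ ℓ : ℝ) (T K : ℕ),
            τ = Dφ ^ (2 * (2 * c - 1)) * (d : ℝ) ^ (2 - 2 * c) →
            ℓ = Dφ ^ (2 * (2 * c - 1)) →
            T = tunedT τ Dφ Dθ Dβ (Real.log (Fintype.card A)) ε →
            K = tunedK τ ℓ Dφ Dθ Dβ (Real.log (Fintype.card A)) T →
            (∃ hT : 0 < T, ∀ init : Init d, init.Feasible Dθ Dβ →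
              expect (M.run φ c (occ πB) Dθ Dβ
                  (tunedRates τ ℓ Dφ Dθ Dβ (Real.log (Fintype.card A)) T K) T K hT init)
                (fun o => M.value (occ πs) - M.value (occ o.1)) ≤ ε) ∧
            ((T * (K + 1) : ℕ) : ℝ)
              ≤ C * (ε⁻¹ ^ 4 * Dθ ^ 4 * Dφ ^ (12 * c - 2) * Dβ ^ 4 * (d : ℝ) ^ (2 - 2 * c)
                  * Real.log (Fintype.card A)))) := by
  refine ⟨sampleConst, by norm_num [sampleConst], ?_⟩
  intro X A _ _ _ d M φ c Dφ Dθ Dβ πB πs occ hc hM hϱ hφ hocc hbias hu hDβ hcov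
  obtain ⟨⟨x₀, a₀⟩, -⟩ := (occ πB).support_nonempty
  have hDφ : 0 ≤ Dφ := (norm_nonneg _).trans (hφ x₀ a₀)
  have hDθ : 0 ≤ Dθ := by
    obtain ⟨θ, hθ, -⟩ := hbias πB
    exact (norm_nonneg _).trans hθ
  -- In dimension zero `⟨φ, ϱ⟩ = 1` would read `0 = 1`.
  have hd : 1 ≤ d := by
    rcases Nat.eq_zero_or_pos d with rfl | h
    · obtain ⟨ϱ, hϱ⟩ := hϱ
      have := hϱ x₀ a₀
      simp [PiLp.inner_apply] at this
    · exact h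
  refine ⟨?_, ?_⟩
  · intro lr T K hT init hζ hα hξ hη hK hi
    obtain ⟨βs, hcert⟩ := exists_isDualCertificate hc hu hDβ hcov le_rfl le_rfl
    exact ⟨expect_primalDual_le hM hϱ hφ hDφ hDθ hDβ hocc hbias hcert hζ hα hξ hη hT hK hi,
      used_of_mem_support_primalDual _ φ _ hDθ hDβ lr hT hK hi⟩
  · intro ε hε hε1 hA hp
    refine ⟨?_, ?_⟩
    · intro τ ℓ T K hτ hℓ hT hK
      have hℓτ : ℓ ≤ τ := by
        rw [hτ, hℓ]
        exact specNorm_rpow_le_trace_rpow hc hd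
      obtain ⟨h1, h2⟩ := tuned_run_le hc hM hϱ hφ hDφ hDθ hDβ hocc hbias hu hcov hτ.symm.le
        hℓ.symm.le hℓτ hε hε1 hA hp hT hK
      refine ⟨h1, h2, fun hΛ => h2.trans ?_⟩
      have hℓ0 : 0 ≤ ℓ := by
        rw [hℓ]
        exact Real.rpow_nonneg (specNorm_nonneg _) _
      have hτ0 : 0 ≤ τ := hℓ0.trans hℓτ
      have hlog : 0 ≤ Real.log (Fintype.card A) := Real.log_natCast_nonneg _
      have hle : ℓ ≤ specNorm (covariance φ (occ πB)) ^ (2 * (2 * c - 1)) := by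
        rw [hℓ]
        refine Real.rpow_le_rpow_of_exponent_le hΛ ?_
        rcases hc with rfl | rfl <;> norm_num
      have hC : 0 ≤ sampleConst := by norm_num [sampleConst]
      gcongr
    · intro hDφ1 τ ℓ T K hτ hℓ hT hK
      have hd' : (1 : ℝ) ≤ d := by exact_mod_cast hd
      have hℓτ : ℓ ≤ τ := by
        rw [hτ, hℓ]
        refine le_mul_of_one_le_right (Real.rpow_nonneg hDφ _) (Real.one_le_rpow hd' ?_)
        rcases hc with rfl | rfl <;> norm_num
      obtain ⟨h1, h2⟩ := tuned_run_le hc hM hϱ hφ hDφ hDθ hDβ hocc hbias hu hcov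
        (hτ ▸ trace_rpow_le hc hφ) (hℓ ▸ specNorm_rpow_le_bound hc hφ) hℓτ hε hε1 hA hp hT hK
      refine ⟨h1, h2.trans ?_⟩
      have hlog : 0 ≤ Real.log (Fintype.card A) := Real.log_natCast_nonneg _
      have hC : 0 ≤ sampleConst := by norm_num [sampleConst]
      have hdc : 0 ≤ (d : ℝ) ^ (2 - 2 * c) := by positivity
      have hDpos : 0 < Dφ := by linarith
      -- The exponents add up to `8c`, which is at most `12c - 2` because `c ≥ 1/2`, and `Dφ ≥ 1`.
      have hpow : Dφ ^ 4 * Dφ ^ (2 * (2 * c - 1)) * Dφ ^ (2 * (2 * c - 1))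
          ≤ Dφ ^ (12 * c - 2) := by
        rw [← Real.rpow_natCast Dφ 4, ← Real.rpow_add hDpos, ← Real.rpow_add hDpos]
        refine Real.rpow_le_rpow_of_exponent_le hDφ1 ?_
        rcases hc with rfl | rfl <;> norm_num
      calc _ = sampleConst * (ε⁻¹ ^ 4 * Dθ ^ 4
            * (Dφ ^ 4 * Dφ ^ (2 * (2 * c - 1)) * Dφ ^ (2 * (2 * c - 1)))
            * Dβ ^ 4 * (d : ℝ) ^ (2 - 2 * c) * Real.log (Fintype.card A)) := by
            rw [hτ, hℓ]
            ring
        _ ≤ _ := by gcongr
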